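/- **Theorem 4.4.** Let $n\ge 2$ and let $D\subset\mathbf C^n$ be a domain (non-empty, open, connected). Let $a=(a_{i\bar j}(z))$ be a smooth positive definite Hermitian matrix function on $D$, let $b_1,\dots,b_n:D\to\mathbf C$ be smooth functions, and let $$\alpha(z,\eta)=\sqrt{a_{i\bar j}(z)\eta^i\bar\eta^j},\qquad \beta(z,\eta)=b_i(z)\eta^i,\qquad \tilde F=\alpha+|\beta| ,\qquad F(z,\eta)=|\eta|=\Big(\sum_i|\eta^i|^2\Big)^{1/2}$$ for $z\in D$, $\eta\in\mathbf C^n$, so that $\tilde F$ is a complex Randers metric and $F$ is the complex Euclidean metric on $D$. Then $F$ and $\tilde F$ are projectively related if and only if $\alpha$ is projectively related to $F$ and $\tilde F$ is a complex Berwald metric. *Terms.* For a metric $H(z,\eta)$ on $D$ put $L=H^2$; a point $(z,\eta)$ with $z\in D$, $\eta\neq0$ is *regular* for $H$ if $L$ is smooth near it. (All such points are regular for $\alpha$ and for the Euclidean metric; for $\tilde F$ all those with $\beta(z,\eta)\ne0$ are.) At regular points put $$g_{i\bar j}=\frac{\partial^2L}{\partial\eta^i\partial\bar\eta^j},\quad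 (g^{\bar m i})=(g_{i\bar m})^{-1},\quad N^i_j=g^{\bar mi}\frac{\partial g_{l\bar m}}{\partial z^j}\eta^l,\quad \delta_k=\frac{\partial}{\partial z^k}-N^j_k\frac{\partial}{\partial\eta^j},\quad L^i_{jk}=g^{\bar li}\delta_kg_{j\bar l},$$ $$T^i_{jk}=L^i_{jk}-L^i_{kj},\qquad G^i=\tfrac12N^i_j\eta^j,\qquad \theta^{*k}=g^{\bar mk}g_{i\bar p}\,\overline{T^p_{jm}}\,\eta^i\bar\eta^j .$$ The metric is *complex Berwald* if $T^i_{jk}\eta^j=0$ (Kähler) and $\partial G^i/\partial\bar\eta^h=0$ (generalized Berwald) at all regular points. A *complex geodesic* is a $C^2$ curve $z=z(s)$ in $D$, with $s$ in an open interval, such that all $(z,dz/ds)$ are regular and $\frac{d^2z^i}{ds^2}+2G^i(z,\frac{dz}{ds})=\theta^{*i}(z,\frac{dz}{ds})$ for $i=1,\dots,n$. Two metrics are *projectively related* if they have the same complex geodesics as point sets: every complex geodesic $z(s)$ of one of them all of whose points $(z,dz/ds)$ are regular for the other becomes a complex geodesic of the other after a $C^2$ change of the real parameter $\tilde s=\tilde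 s(s)$ with $d\tilde s/ds>0$, and conversely. -/

import Mathlib

open scoped ComplexOrder ContDiff ComplexConjugate Topology

noncomputable section

namespace ComplexFinsler

/-- Coordinate vectors of `ℂⁿ`; they serve both as points `z` and as tangent vectors `η`. -/
abbrev Cn (n : ℕ) : Type := Fin n → ℂ

variable {n : ℕ}

/-- Wirtinger derivative `∂f/∂xᵏ = (∂f/∂Re xᵏ - i ∂f/∂Im xᵏ)/2` at `x`. -/
def wirt (k : Fin n) (f : Cn n → ℂ) (x : Cn n) : ℂ :=
  (1 / 2 : ℂ) * (fderiv ℝ f x (Pi.single k 1) - Complex.I * fderiv ℝ f x (Pi.single k Complex.I))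

/-- Wirtinger derivative `∂f/∂x̄ᵏ = (∂f/∂Re xᵏ + i ∂f/∂Im xᵏ)/2` at `x`. -/
def wirtBar (k : Fin n) (f : Cn n → ℂ) (x : Cn n) : ℂ :=
  (1 / 2 : ℂ) * (fderiv ℝ f x (Pi.single k 1) + Complex.I * fderiv ℝ f x (Pi.single k Complex.I))

/-- `∂f/∂zᵏ` for a function `f(z, η)`. -/
def dz (k : Fin n) (f : Cn n → Cn n → ℂ) (z η : Cn n) : ℂ := wirt k (fun z' => f z' η) z

/-- `∂f/∂ηᵏ` for a function `f(z, η)`. -/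
def dEta (k : Fin n) (f : Cn n → Cn n → ℂ) (z η : Cn n) : ℂ := wirt k (f z) η

/-- `∂f/∂η̄ᵏ` for a function `f(z, η)`. -/
def dEtaBar (k : Fin n) (f : Cn n → Cn n → ℂ) (z η : Cn n) : ℂ := wirtBar k (f z) η

/-- `L = F²`, regarded as a complex-valued function. -/
def lagr (F : Cn n → Cn n → ℝ) (z η : Cn n) : ℂ := ((F z η ^ 2 : ℝ) : ℂ)

/-- `(z, η)` is a regular point of `F`: `η ≠ 0` and `F²` is smooth near `(z, η)`. For a metric which
is smooth off the zero section these are all the `(z, η)` with `η ≠ 0`; for `α + |β|` the directions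
with `β(z, η) = 0`, where `|β|` is not differentiable, have to be left out. -/
def IsRegular (F : Cn n → Cn n → ℝ) (z η : Cn n) : Prop :=
  η ≠ 0 ∧ ∀ᶠ q : Cn n × Cn n in 𝓝 (z, η),
    ContDiffAt ℝ ∞ (fun p : Cn n × Cn n => F p.1 p.2 ^ 2) q

/-- The fundamental tensor: the `(i, j)` entry is `g_{i j̄} = ∂²L/∂ηⁱ∂η̄ʲ`. -/
def fund (F : Cn n → Cn n → ℝ) (z η : Cn n) : Matrix (Fin n) (Fin n) ℂ :=
  Matrix.of fun i j => dEta i (dEtaBar j (lagr F)) z η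

/-- The inverse of the fundamental tensor: the `(m, i)` entry is `g^{m̄ i}`, where
`g_{l m̄} g^{m̄ i} = δ_lⁱ`. -/
def fundInv (F : Cn n → Cn n → ℝ) (z η : Cn n) : Matrix (Fin n) (Fin n) ℂ := (fund F z η)⁻¹

/-- Chern–Finsler nonlinear connection `Nⁱ_j = g^{m̄ i} (∂g_{l m̄}/∂zʲ) ηˡ`. -/
def nonlinConn (F : Cn n → Cn n → ℝ) (i j : Fin n) (z η : Cn n) : ℂ :=
  ∑ m, ∑ l, fundInv F z η m i * dz j (fun z' η' => fund F z' η' l m) z η * η l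

/-- The horizontal derivative `δ_k f = ∂f/∂zᵏ - Nʲ_k ∂f/∂ηʲ` of the Chern–Finsler connection. -/
def hDeriv (F : Cn n → Cn n → ℝ) (k : Fin n) (f : Cn n → Cn n → ℂ) (z η : Cn n) : ℂ :=
  dz k f z η - ∑ j, nonlinConn F j k z η * dEta j f z η

/-- Horizontal coefficients `Lⁱ_{jk} = g^{l̄ i} δ_k g_{j l̄}` of the Chern–Finsler connection. -/
def hCoeff (F : Cn n → Cn n → ℝ) (i j k : Fin n) (z η : Cn n) : ℂ :=
  ∑ l, fundInv F z η l i * hDeriv F k (fun z' η' => fund F z' η' j l) z η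

/-- The torsion `Tⁱ_{jk} = Lⁱ_{jk} - Lⁱ_{kj}`. -/
def torsion (F : Cn n → Cn n → ℝ) (i j k : Fin n) (z η : Cn n) : ℂ :=
  hCoeff F i j k z η - hCoeff F i k j z η

/-- Spray coefficients `Gⁱ = Nⁱ_j ηʲ / 2`. -/
def spray (F : Cn n → Cn n → ℝ) (i : Fin n) (z η : Cn n) : ℂ :=
  (1 / 2 : ℂ) * ∑ j, nonlinConn F i j z η * η j

/-- `θ*ᵏ = g^{m̄ k} g_{i p̄} (L^{p̄}_{j̄ m̄} - L^{p̄}_{m̄ j̄}) ηⁱ η̄ʲ`. -/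
def thetaStar (F : Cn n → Cn n → ℝ) (k : Fin n) (z η : Cn n) : ℂ :=
  ∑ m, ∑ i, ∑ p, ∑ j,
    fundInv F z η m k * fund F z η i p * conj (torsion F p j m z η) * η i * conj (η j)

/-- `F` is Kähler on `D`: `Tⁱ_{jk} ηʲ = 0`. -/
def IsKahler (D : Set (Cn n)) (F : Cn n → Cn n → ℝ) : Prop :=
  ∀ z ∈ D, ∀ η, IsRegular F z η → ∀ i k, ∑ j, torsion F i j k z η * η j = 0

/-- `F` is generalized Berwald on `D`: `∂Gⁱ/∂η̄ʰ = 0`. -/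
def IsGeneralizedBerwald (D : Set (Cn n)) (F : Cn n → Cn n → ℝ) : Prop :=
  ∀ z ∈ D, ∀ η, IsRegular F z η → ∀ i h, dEtaBar h (spray F i) z η = 0

/-- `F` is a complex Berwald metric on `D`: Kähler and generalized Berwald. -/
def IsComplexBerwald (D : Set (Cn n)) (F : Cn n → Cn n → ℝ) : Prop :=
  IsKahler D F ∧ IsGeneralizedBerwald D F

/-- The curve `z : I → D` runs on the regular points of `F`. -/
def IsAdmissible (F : Cn n → Cn n → ℝ) (I : Set ℝ) (z : ℝ → Cn n) : Prop :=
  ∀ s ∈ I, IsRegular F (z s) (deriv z s)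

/-- `z`, defined on the open interval `I` of the real parameter `s`, is a complex geodesic of
`(D, F)`: `d²zⁱ/ds² + 2 Gⁱ(z, dz/ds) = θ*ⁱ(z, dz/ds)`. -/
structure IsComplexGeodesic (D : Set (Cn n)) (F : Cn n → Cn n → ℝ) (I : Set ℝ)
    (z : ℝ → Cn n) : Prop where
  isOpen : IsOpen I
  ordConnected : I.OrdConnected
  contDiffOn : ContDiffOn ℝ 2 z I
  mem : ∀ s ∈ I, z s ∈ D
  admissible : IsAdmissible F I z
  eqn : ∀ s ∈ I, ∀ i,
    deriv (deriv z) s i + 2 * spray F i (z s) (deriv z s) = thetaStar F i (z s) (deriv z s)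

/-- Every complex geodesic `z = z(s)` of `F` (running on regular points of `F'`) becomes a complex
geodesic `w` of `F'` under a change of parameter `t = φ(s)` with `dt/ds > 0`, i.e.
`z(s) = w(φ(s))`. -/
def GeodesicsReparametrize (D : Set (Cn n)) (F F' : Cn n → Cn n → ℝ) : Prop :=
  ∀ (I : Set ℝ) (z : ℝ → Cn n), IsComplexGeodesic D F I z → IsAdmissible F' I z →
    ∃ (φ : ℝ → ℝ) (w : ℝ → Cn n), ContDiffOn ℝ 2 φ I ∧ (∀ s ∈ I, 0 < deriv φ s) ∧
      IsComplexGeodesic D F' (φ '' I) w ∧ ∀ s ∈ I, w (φ s) = z s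

/-- `F` and `F'` are projectively related on `D`: they have the same complex geodesics as
point sets. -/
def ProjectivelyRelated (D : Set (Cn n)) (F F' : Cn n → Cn n → ℝ) : Prop :=
  GeodesicsReparametrize D F F' ∧ GeodesicsReparametrize D F' F

/-- The complex Euclidean metric `F(z, η) = |η|`. -/
def euclideanMetric (_z η : Cn n) : ℝ := √(∑ i, ‖η i‖ ^ 2)

/-- The purely Hermitian metric `α(z, η) = √(a_{i j̄}(z) ηⁱ η̄ʲ)`. -/
def hermitianMetric (a : Cn n → Matrix (Fin n) (Fin n) ℂ) (z η : Cn n) : ℝ :=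
  √(∑ i, ∑ j, a z i j * η i * conj (η j)).re

/-- The complex Randers metric `α + |β|` with `β(z, η) = b_i(z) ηⁱ`. -/
def randersMetric (a : Cn n → Matrix (Fin n) (Fin n) ℂ) (b : Cn n → Cn n) (z η : Cn n) : ℝ :=
  hermitianMetric a z η + ‖∑ i, b z i * η i‖

end ComplexFinsler

end

/-! Both sides of the equivalence amount to first-order independence of the base point: `∂L/∂zᵏ = 0`
at the regular points, for `L = α²` and for `L = (α + |β|)²`. A metric with this property
(`IsStationary`) has vanishing connection, spray, torsion and `θ*`. It is therefore complex Berwald,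
and its geodesic equation is `z'' = 0`, as for the Euclidean metric. What remains is to derive
stationarity from either side.

From geodesics (`GeodesicsReparametrize.del_lagrProd_eq_zero`). If straight lines reparametrize to
geodesics of a metric, then `2Gⁱ - θ*ⁱ = P ηⁱ` with `P` real. Contracting with `∂L/∂ηⁱ` kills `θ*`,
since the torsion is antisymmetric, and leaves `ηʲ ∂L/∂zʲ = P L`, a real number. But `ηʲ ∂L/∂zʲ` is
multiplied by `c|c|²` under `η ↦ cη`, so being real at both `η` and `iη` it is zero. Its
`η̄`-derivative is the lowered spray, so `G = 0`, then `P = 0` and `θ* = 0`; lowered, `θ*` is now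
the conjugate of `2 ∂L/∂zᵏ`. The argument needs `g_{i j̄}` invertible, which for the Randers metric
holds where `β ≠ 0` (`levi_randersMetric_pos`).

From Randers to `α` (`fderiv_sesqProd_eq_zero`). Stationarity of `α + |β|` equates `|β|` times a
quadratic form in `η` with `α` times another. On a real line through a nonzero zero `u` of `β`,
which exists since `n ≥ 2`, the factor `|β|` has a corner while `α` is continuous and nonzero, and
this forces the forms to vanish. Base points where `b` vanishes are handled by continuity, or by
noting that the metric is `α` over an open set.

From Berwald (`spray_randersMetric_eq_zero`). Let `α` be stationary and `G` holomorphic in `η`.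
Squaring the contracted spray identity gives `4 |β|² Γ² = α² m²` with `Γ = a(G, η)`. In an
antiholomorphic direction `ū` with `β(u) = 0`, the factors `Γ`, `m` have degree at most one, `α²`
has degree exactly one and `|β|²` is constant. Comparing degrees gives `Γ = 0`, hence `G = 0`, and
the Kähler condition then yields `∂L/∂zᵏ = 0`. -/

noncomputable section

namespace ComplexFinsler

/-! ### Real derivatives of smooth complex-valued functions. -/

section RealSmooth

variable {E : Type*} [NormedAddCommGroup E] [NormedSpace ℝ E] {f : E → ℂ} {x : E} {U : Set E}

lemma fderiv_conj_comp (v : E) :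
    fderiv ℝ (fun y => conj (f y)) x v = conj (fderiv ℝ f x v) := by
  have := (Complex.conjCLE.comp_fderiv (f := f) (x := x))
  have h2 : fderiv ℝ (fun y => conj (f y)) x = fderiv ℝ (Complex.conjCLE ∘ f) x := rfl
  rw [h2, this]; simp

lemma differentiableAt_of_contDiffOn (hU : IsOpen U) (hf : ContDiffOn ℝ ∞ f U) (hx : x ∈ U) :
    DifferentiableAt ℝ f x :=
  (hf.contDiffAt (hU.mem_nhds hx)).differentiableAt (by simp)

lemma fderiv_fderiv_apply_comm (hU : IsOpen U) (hf : ContDiffOn ℝ ∞ f U) (hx : x ∈ U) (u v : E) :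
    fderiv ℝ (fun y => fderiv ℝ f y u) x v = fderiv ℝ (fun y => fderiv ℝ f y v) x u := by
  have hd : DifferentiableAt ℝ (fderiv ℝ f) x :=
    ((hf.fderiv_of_isOpen (m := ∞) hU (by simp)).contDiffAt (hU.mem_nhds hx)).differentiableAt
      (by simp)
  have hs : IsSymmSndFDerivAt ℝ f x :=
    (hf.contDiffAt (hU.mem_nhds hx)).isSymmSndFDerivAt
      (by simpa using WithTop.coe_le_coe.2 (le_top (a := (2 : ℕ∞))))
  rw [fderiv_clm_apply hd (differentiableAt_const _), fderiv_clm_apply hd (differentiableAt_const _)]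
  simpa using hs v u

lemma fderiv_apply_differentiableAt (hU : IsOpen U) (hf : ContDiffOn ℝ ∞ f U) (hx : x ∈ U) (u : E) :
    DifferentiableAt ℝ (fun y => fderiv ℝ f y u) x :=
  differentiableAt_of_contDiffOn hU
    ((hf.fderiv_of_isOpen hU (by simp)).clm_apply contDiffOn_const) hx

end RealSmooth

/-! ### Wirtinger calculus in arbitrary directions. -/

section Wirtinger

variable {E : Type*} [NormedAddCommGroup E] [NormedSpace ℂ E] [NormedSpace ℝ E]

/-- The `(1, 0)`-part of the real derivative of `f` in the direction `u`. -/
def del (u : E) (f : E → ℂ) (x : E) : ℂ :=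
  (1 / 2 : ℂ) * (fderiv ℝ f x u - Complex.I * fderiv ℝ f x (Complex.I • u))

/-- The `(0, 1)`-part of the real derivative of `f` in the direction `u`. -/
def dbar (u : E) (f : E → ℂ) (x : E) : ℂ :=
  (1 / 2 : ℂ) * (fderiv ℝ f x u + Complex.I * fderiv ℝ f x (Complex.I • u))

variable {f g : E → ℂ} {x : E} {u v : E} {U : Set E}

lemma del_congr (h : f =ᶠ[𝓝 x] g) : del u f x = del u g x := by
  simp only [del, h.fderiv_eq]

lemma dbar_congr (h : f =ᶠ[𝓝 x] g) : dbar u f x = dbar u g x := by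
  simp only [dbar, h.fderiv_eq]

lemma del_congr_of_eqOn (hU : IsOpen U) (h : Set.EqOn f g U) (hx : x ∈ U) :
    del u f x = del u g x :=
  del_congr (h.eventuallyEq_of_mem (hU.mem_nhds hx))

lemma dbar_congr_of_eqOn (hU : IsOpen U) (h : Set.EqOn f g U) (hx : x ∈ U) :
    dbar u f x = dbar u g x :=
  dbar_congr (h.eventuallyEq_of_mem (hU.mem_nhds hx))

@[simp] lemma del_const (c : ℂ) : del u (fun _ : E => c) x = 0 := by simp [del]

@[simp] lemma dbar_const (c : ℂ) : dbar u (fun _ : E => c) x = 0 := by simp [dbar]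

lemma fderiv_eq_del_add_dbar : fderiv ℝ f x u = del u f x + dbar u f x := by
  simp only [del, dbar]; ring

lemma del_add (hf : DifferentiableAt ℝ f x) (hg : DifferentiableAt ℝ g x) :
    del u (fun y => f y + g y) x = del u f x + del u g x := by
  simp only [del, fderiv_fun_add hf hg, add_apply]; ring

lemma dbar_add (hf : DifferentiableAt ℝ f x) (hg : DifferentiableAt ℝ g x) :
    dbar u (fun y => f y + g y) x = dbar u f x + dbar u g x := by
  simp only [dbar, fderiv_fun_add hf hg, add_apply]; ring

lemma del_mul (hf : DifferentiableAt ℝ f x) (hg : DifferentiableAt ℝ g x) :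
    del u (fun y => f y * g y) x = f x * del u g x + g x * del u f x := by
  simp only [del, fderiv_fun_mul hf hg, add_apply,
    smul_apply, smul_eq_mul]; ring

lemma dbar_mul (hf : DifferentiableAt ℝ f x) (hg : DifferentiableAt ℝ g x) :
    dbar u (fun y => f y * g y) x = f x * dbar u g x + g x * dbar u f x := by
  simp only [dbar, fderiv_fun_mul hf hg, add_apply,
    smul_apply, smul_eq_mul]; ring

lemma del_const_mul (c : ℂ) (hf : DifferentiableAt ℝ f x) :
    del u (fun y => c * f y) x = c * del u f x := by
  rw [del_mul (differentiableAt_const c) hf]; simp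

lemma dbar_const_mul (c : ℂ) (hf : DifferentiableAt ℝ f x) :
    dbar u (fun y => c * f y) x = c * dbar u f x := by
  rw [dbar_mul (differentiableAt_const c) hf]; simp

lemma del_sum {ι : Type*} {s : Finset ι} {F : ι → E → ℂ}
    (hF : ∀ i ∈ s, DifferentiableAt ℝ (F i) x) :
    del u (fun y => ∑ i ∈ s, F i y) x = ∑ i ∈ s, del u (F i) x := by
  simp only [del, fderiv_fun_sum hF, sum_apply, Finset.mul_sum,
    ← Finset.sum_sub_distrib]

lemma dbar_sum {ι : Type*} {s : Finset ι} {F : ι → E → ℂ}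
    (hF : ∀ i ∈ s, DifferentiableAt ℝ (F i) x) :
    dbar u (fun y => ∑ i ∈ s, F i y) x = ∑ i ∈ s, dbar u (F i) x := by
  simp only [dbar, fderiv_fun_sum hF, sum_apply, Finset.mul_sum,
    ← Finset.sum_add_distrib]

lemma del_conj : del u (fun y => conj (f y)) x = conj (dbar u f x) := by
  simp only [del, dbar, fderiv_conj_comp]
  simp [Complex.ext_iff, sub_eq_add_neg]

lemma dbar_conj : dbar u (fun y => conj (f y)) x = conj (del u f x) := by
  simp only [del, dbar, fderiv_conj_comp]
  simp [Complex.ext_iff, sub_eq_add_neg]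

lemma dbar_ofReal (φ : E → ℝ) :
    dbar u (fun y => (φ y : ℂ)) x = conj (del u (fun y => (φ y : ℂ)) x) := by
  rw [← dbar_conj]; simp

lemma del_add_dir : del (u + v) f x = del u f x + del v f x := by
  simp only [del, smul_add, map_add]; ring

lemma dbar_add_dir : dbar (u + v) f x = dbar u f x + dbar v f x := by
  simp only [dbar, smul_add, map_add]; ring

@[simp] lemma del_zero_dir : del (0 : E) f x = 0 := by simp [del]

@[simp] lemma dbar_zero_dir : dbar (0 : E) f x = 0 := by simp [dbar]

lemma del_sum_dir {ι : Type*} (s : Finset ι) (w : ι → E) :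
    del (∑ i ∈ s, w i) f x = ∑ i ∈ s, del (w i) f x := by
  classical
  induction s using Finset.induction_on with
  | empty => simp
  | insert a s ha ih => rw [Finset.sum_insert ha, Finset.sum_insert ha, del_add_dir, ih]

lemma dbar_sum_dir {ι : Type*} (s : Finset ι) (w : ι → E) :
    dbar (∑ i ∈ s, w i) f x = ∑ i ∈ s, dbar (w i) f x := by
  classical
  induction s using Finset.induction_on with
  | empty => simp
  | insert a s ha ih => rw [Finset.sum_insert ha, Finset.sum_insert ha, dbar_add_dir, ih]

lemma contDiffOn_del (hU : IsOpen U) (hf : ContDiffOn ℝ ∞ f U) :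
    ContDiffOn ℝ ∞ (del u f) U := by
  have h : ∀ w : E, ContDiffOn ℝ ∞ (fun y => fderiv ℝ f y w) U := fun w =>
    (hf.fderiv_of_isOpen hU (by simp)).clm_apply contDiffOn_const
  exact contDiffOn_const.mul ((h u).sub (contDiffOn_const.mul (h _)))

lemma contDiffOn_dbar (hU : IsOpen U) (hf : ContDiffOn ℝ ∞ f U) :
    ContDiffOn ℝ ∞ (dbar u f) U := by
  have h : ∀ w : E, ContDiffOn ℝ ∞ (fun y => fderiv ℝ f y w) U := fun w =>
    (hf.fderiv_of_isOpen hU (by simp)).clm_apply contDiffOn_const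
  exact contDiffOn_const.mul ((h u).add (contDiffOn_const.mul (h _)))

lemma fderiv_del (hU : IsOpen U) (hf : ContDiffOn ℝ ∞ f U) (hx : x ∈ U) (u w : E) :
    fderiv ℝ (del u f) x w = del u (fun y => fderiv ℝ f y w) x := by
  have h := fderiv_apply_differentiableAt hU hf hx
  have : del u f = fun y => (1 / 2 : ℂ) * (fderiv ℝ f y u - Complex.I * fderiv ℝ f y (Complex.I • u)) :=
    rfl
  rw [this, fderiv_const_mul ((h u).fun_sub ((h _).const_mul _)),
    fderiv_fun_sub (h u) ((h _).const_mul _), fderiv_const_mul (h _)]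
  simp only [del, sub_apply, smul_apply, smul_eq_mul,
    fderiv_fderiv_apply_comm hU hf hx _ w]

lemma fderiv_dbar (hU : IsOpen U) (hf : ContDiffOn ℝ ∞ f U) (hx : x ∈ U) (u w : E) :
    fderiv ℝ (dbar u f) x w = dbar u (fun y => fderiv ℝ f y w) x := by
  have h := fderiv_apply_differentiableAt hU hf hx
  have : dbar u f = fun y => (1 / 2 : ℂ) * (fderiv ℝ f y u + Complex.I * fderiv ℝ f y (Complex.I • u)) :=
    rfl
  rw [this, fderiv_const_mul ((h u).fun_add ((h _).const_mul _)),
    fderiv_fun_add (h u) ((h _).const_mul _), fderiv_const_mul (h _)]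
  simp only [dbar, add_apply, smul_apply, smul_eq_mul,
    fderiv_fderiv_apply_comm hU hf hx _ w]

lemma del_del_comm (hU : IsOpen U) (hf : ContDiffOn ℝ ∞ f U) (hx : x ∈ U) :
    del u (del v f) x = del v (del u f) x := by
  have h := fderiv_apply_differentiableAt hU hf hx
  have e : del v (del u f) x = del v (fun y => (1 / 2 : ℂ) * (fderiv ℝ f y u +
      -Complex.I * fderiv ℝ f y (Complex.I • u))) x := by
    congr 1; ext y; simp only [del]; ring
  rw [e, del_const_mul _ ((h u).fun_add ((h _).const_mul _)), del_add (h u) ((h _).const_mul _),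
    del_const_mul _ (h _), ← fderiv_del hU hf hx, ← fderiv_del hU hf hx, del]
  ring

lemma del_dbar_comm (hU : IsOpen U) (hf : ContDiffOn ℝ ∞ f U) (hx : x ∈ U) :
    del u (dbar v f) x = dbar v (del u f) x := by
  have h := fderiv_apply_differentiableAt hU hf hx
  have e : dbar v (del u f) x = dbar v (fun y => (1 / 2 : ℂ) * (fderiv ℝ f y u +
      -Complex.I * fderiv ℝ f y (Complex.I • u))) x := by
    congr 1; ext y; simp only [del]; ring
  rw [e, dbar_const_mul _ ((h u).fun_add ((h _).const_mul _)), dbar_add (h u) ((h _).const_mul _),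
    dbar_const_mul _ (h _), ← fderiv_dbar hU hf hx, ← fderiv_dbar hU hf hx, del]
  ring

variable [IsScalarTower ℝ ℂ E]

/-- The real derivative is only `ℝ`-linear in the direction; its `(1, 0)`-part is `ℂ`-linear. This
is what allows a direction to be expanded in the coordinate directions with complex coefficients. -/
lemma del_smul_dir (c : ℂ) : del (c • u) f x = c * del u f x := by
  have h0 : ∀ (r : ℝ) (w : E), (r : ℂ) • w = r • w := fun r w => algebraMap_smul ℂ r w
  have h1 : c • u = c.re • u + c.im • (Complex.I • u) := by
    conv_lhs => rw [← Complex.re_add_im c, add_smul, mul_smul]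
    simp only [h0]
  have h2 : Complex.I • (c • u) = c.re • (Complex.I • u) - c.im • u := by
    rw [h1, smul_add, smul_comm Complex.I c.re, smul_comm Complex.I c.im, smul_smul, Complex.I_mul_I]
    simp [sub_eq_add_neg]
  simp only [del, h2]
  rw [h1]
  simp only [map_add, map_sub, map_smul, Complex.real_smul]
  conv_rhs => rw [← Complex.re_add_im c]
  linear_combination (1 / 2 : ℂ) * (c.im : ℂ) * fderiv ℝ f x (Complex.I • u) * Complex.I_sq

lemma dbar_smul_dir (c : ℂ) : dbar (c • u) f x = conj c * dbar u f x := by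
  have h : ∀ w, dbar w f x = conj (del w (fun y => conj (f y)) x) := fun w => by
    rw [← dbar_conj]; simp
  rw [h, h, del_smul_dir, map_mul]

end Wirtinger

lemma dbar_of_differentiableAt {E : Type*} [NormedAddCommGroup E] [NormedSpace ℂ E]
    [NormedSpace ℝ E] [IsScalarTower ℝ ℂ E] {f : E → ℂ} {x u : E} (hf : DifferentiableAt ℂ f x) :
    dbar u f x = 0 := by
  simp only [dbar, (hf.hasFDerivAt.restrictScalars ℝ).fderiv]
  simp only [ContinuousLinearMap.coe_restrictScalars', map_smul, smul_eq_mul]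
  linear_combination (1 / 2 : ℂ) * fderiv ℂ f x u * Complex.I_sq

lemma del_of_differentiableAt {E : Type*} [NormedAddCommGroup E] [NormedSpace ℂ E]
    [NormedSpace ℝ E] [IsScalarTower ℝ ℂ E] {f : E → ℂ} {x u : E} (hf : DifferentiableAt ℂ f x) :
    del u f x = fderiv ℂ f x u := by
  simp only [del, (hf.hasFDerivAt.restrictScalars ℝ).fderiv]
  simp only [ContinuousLinearMap.coe_restrictScalars', map_smul, smul_eq_mul]
  linear_combination (-1 / 2 : ℂ) * fderiv ℂ f x u * Complex.I_sq

/-! ### Partial Wirtinger derivatives as directional ones on the product of base and fibre. -/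

section Product

variable {n : ℕ}

/-- The `k`-th coordinate direction of the base. -/
def ez (k : Fin n) : Cn n × Cn n := (Pi.single k 1, 0)

/-- The `k`-th coordinate direction of the fibre. -/
def ev (k : Fin n) : Cn n × Cn n := (0, Pi.single k 1)

lemma sum_smul_single (η : Cn n) : ∑ k, η k • (Pi.single k 1 : Cn n) = η := by
  ext i; simp [Finset.sum_apply, Pi.single_apply]

lemma sum_smul_ev (η : Cn n) : ∑ k, η k • (ev k : Cn n × Cn n) = (0, η) := by
  apply Prod.ext
  · simp [ev, Prod.fst_sum]
  · simp only [ev, Prod.snd_sum, Prod.smul_snd, sum_smul_single]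

lemma sum_smul_ez (η : Cn n) : ∑ k, η k • (ez k : Cn n × Cn n) = (η, 0) := by
  apply Prod.ext
  · simp only [ez, Prod.fst_sum, Prod.smul_fst, sum_smul_single]
  · simp [ez, Prod.snd_sum]

lemma wirt_eq_del (k : Fin n) (f : Cn n → ℂ) (x : Cn n) :
    wirt k f x = del (Pi.single k 1) f x := by
  simp [wirt, del, ← Pi.single_smul]

lemma wirtBar_eq_dbar (k : Fin n) (f : Cn n → ℂ) (x : Cn n) :
    wirtBar k f x = dbar (Pi.single k 1) f x := by
  simp [wirtBar, dbar, ← Pi.single_smul]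

variable {U : Set (Cn n × Cn n)} {p : Cn n × Cn n} {f : Cn n → Cn n → ℂ} {g : Cn n × Cn n → ℂ}

lemma fderiv_slice_left (hg : DifferentiableAt ℝ g p) (v : Cn n) :
    fderiv ℝ (fun z => g (z, p.2)) p.1 v = fderiv ℝ g p (v, 0) := by
  have h := HasFDerivAt.comp (g := g) p.1 (hg.hasFDerivAt) (hasFDerivAt_prodMk_left (𝕜 := ℝ) p.1 p.2)
  have h2 : HasFDerivAt (fun z => g (z, p.2)) _ p.1 := h
  rw [h2.fderiv]; simp

lemma fderiv_slice_right (hg : DifferentiableAt ℝ g p) (v : Cn n) :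
    fderiv ℝ (fun η => g (p.1, η)) p.2 v = fderiv ℝ g p (0, v) := by
  have h := HasFDerivAt.comp (g := g) p.2 (hg.hasFDerivAt) (hasFDerivAt_prodMk_right (𝕜 := ℝ) p.1 p.2)
  have h2 : HasFDerivAt (fun η => g (p.1, η)) _ p.2 := h
  rw [h2.fderiv]; simp

lemma del_slice_left (hg : DifferentiableAt ℝ g p) (v : Cn n) :
    del v (fun z => g (z, p.2)) p.1 = del (v, 0) g p := by
  simp [del, fderiv_slice_left hg]

lemma del_slice_right (hg : DifferentiableAt ℝ g p) (v : Cn n) :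
    del v (fun η => g (p.1, η)) p.2 = del (0, v) g p := by
  simp [del, fderiv_slice_right hg]

lemma dbar_slice_right (hg : DifferentiableAt ℝ g p) (v : Cn n) :
    dbar v (fun η => g (p.1, η)) p.2 = dbar (0, v) g p := by
  simp [dbar, fderiv_slice_right hg]

lemma eventuallyEq_slice_left (hU : IsOpen U) (hfg : ∀ q ∈ U, f q.1 q.2 = g q) (hp : p ∈ U) :
    (fun z => f z p.2) =ᶠ[𝓝 p.1] fun z => g (z, p.2) := by
  have : ContinuousAt (fun z : Cn n => (z, p.2)) p.1 := by fun_prop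
  filter_upwards [this.preimage_mem_nhds (hU.mem_nhds hp)] with z hz using hfg _ hz

lemma eventuallyEq_slice_right (hU : IsOpen U) (hfg : ∀ q ∈ U, f q.1 q.2 = g q) (hp : p ∈ U) :
    f p.1 =ᶠ[𝓝 p.2] fun η => g (p.1, η) := by
  have : ContinuousAt (fun η : Cn n => (p.1, η)) p.2 := by fun_prop
  filter_upwards [this.preimage_mem_nhds (hU.mem_nhds hp)] with z hz using hfg _ hz

lemma dz_eq_del (hU : IsOpen U) (hfg : ∀ q ∈ U, f q.1 q.2 = g q) (hp : p ∈ U)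
    (hg : DifferentiableAt ℝ g p) (k : Fin n) : dz k f p.1 p.2 = del (ez k) g p := by
  rw [dz, wirt_eq_del, del_congr (eventuallyEq_slice_left hU hfg hp), del_slice_left hg, ez]

lemma dEta_eq_del (hU : IsOpen U) (hfg : ∀ q ∈ U, f q.1 q.2 = g q) (hp : p ∈ U)
    (hg : DifferentiableAt ℝ g p) (k : Fin n) : dEta k f p.1 p.2 = del (ev k) g p := by
  rw [dEta, wirt_eq_del, del_congr (eventuallyEq_slice_right hU hfg hp), del_slice_right hg, ev]

lemma dEtaBar_eq_dbar (hU : IsOpen U) (hfg : ∀ q ∈ U, f q.1 q.2 = g q) (hp : p ∈ U)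
    (hg : DifferentiableAt ℝ g p) (k : Fin n) : dEtaBar k f p.1 p.2 = dbar (ev k) g p := by
  rw [dEtaBar, wirtBar_eq_dbar, dbar_congr (eventuallyEq_slice_right hU hfg hp),
    dbar_slice_right hg, ev]

lemma differentiableAt_snd_apply (k : Fin n) : DifferentiableAt ℂ (fun q : Cn n × Cn n => q.2 k) p := by
  fun_prop

lemma differentiableAt_real_snd_apply (k : Fin n) :
    DifferentiableAt ℝ (fun q : Cn n × Cn n => q.2 k) p := by
  fun_prop

lemma differentiableAt_real_conj_snd_apply (k : Fin n) :
    DifferentiableAt ℝ (fun q : Cn n × Cn n => conj (q.2 k)) p :=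
  Complex.conjCLE.differentiableAt.comp p (differentiableAt_real_snd_apply k)

lemma fderiv_snd_apply (k : Fin n) (u : Cn n × Cn n) :
    fderiv ℂ (fun q : Cn n × Cn n => q.2 k) p u = u.2 k := by
  have : HasFDerivAt (fun q : Cn n × Cn n => q.2 k)
    ((ContinuousLinearMap.proj (R := ℂ) k).comp (ContinuousLinearMap.snd ℂ (Cn n) (Cn n))) p :=
    ((ContinuousLinearMap.proj (R := ℂ) k).comp
      (ContinuousLinearMap.snd ℂ (Cn n) (Cn n))).hasFDerivAt
  rw [this.fderiv]; simp

lemma del_snd_apply (k : Fin n) (u : Cn n × Cn n) :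
    del u (fun q : Cn n × Cn n => q.2 k) p = u.2 k := by
  rw [del_of_differentiableAt (differentiableAt_snd_apply k), fderiv_snd_apply]

lemma dbar_snd_apply (k : Fin n) (u : Cn n × Cn n) :
    dbar u (fun q : Cn n × Cn n => q.2 k) p = 0 :=
  dbar_of_differentiableAt (differentiableAt_snd_apply k)

lemma del_conj_snd_apply (k : Fin n) (u : Cn n × Cn n) :
    del u (fun q : Cn n × Cn n => conj (q.2 k)) p = 0 := by
  rw [del_conj, dbar_snd_apply, map_zero]

end Product

/-! ### Euler identities for a homogeneous metric. -/

section Homogeneous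

variable {n : ℕ} {F : Cn n → Cn n → ℝ} {U : Set (Cn n × Cn n)} {p : Cn n × Cn n}

/-- The Lagrangian as a function on the product. -/
def lagrProd (F : Cn n → Cn n → ℝ) (p : Cn n × Cn n) : ℂ := lagr F p.1 p.2

/-- Absolute homogeneity under complex scalars. -/
def IsHomogeneous (F : Cn n → Cn n → ℝ) : Prop := ∀ z η (c : ℂ), F z (c • η) = ‖c‖ * F z η

/-- The derivative of the Lagrangian along the complex spray direction, `ηʲ ∂L/∂zʲ`. -/
def lagrFlow (F : Cn n → Cn n → ℝ) (p : Cn n × Cn n) : ℂ :=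
  ∑ j, p.2 j * del (ez j) (lagrProd F) p

lemma dbar_lagrProd (u : Cn n × Cn n) :
    dbar u (lagrProd F) p = conj (del u (lagrProd F) p) := dbar_ofReal _

lemma lagrProd_smul (hF : IsHomogeneous F) (z η : Cn n) (c : ℂ) :
    lagrProd F (z, c • η) = (‖c‖ ^ 2 : ℝ) * lagrProd F (z, η) := by
  simp only [lagrProd, lagr, hF z η c]; push_cast; ring

/-- Along `t ↦ (1 + tc)η` homogeneity gives `L = |1 + tc|² L(η)`, whose derivative at `0` is
explicit. The cases `c = 1` and `c = i` together give the complex Euler identity. -/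
lemma fderiv_lagrProd_fibre (hF : IsHomogeneous F) (hd : DifferentiableAt ℝ (lagrProd F) p) (c : ℂ) :
    fderiv ℝ (lagrProd F) p (0, c • p.2) = (2 * c.re : ℝ) * lagrProd F p := by
  have hγ : HasDerivAt (fun t : ℝ => p + t • ((0, c • p.2) : Cn n × Cn n)) (0, c • p.2) 0 := by
    simpa using ((hasDerivAt_id (0 : ℝ)).smul_const ((0, c • p.2) : Cn n × Cn n)).const_add p
  have hd' : HasFDerivAt (lagrProd F) (fderiv ℝ (lagrProd F) p)
      (p + (0 : ℝ) • ((0, c • p.2) : Cn n × Cn n)) := by simpa using hd.hasFDerivAt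
  have h1 := hd'.comp_hasDerivAt (0 : ℝ) hγ
  have h2 : (lagrProd F ∘ fun t : ℝ => p + t • ((0, c • p.2) : Cn n × Cn n)) =
      fun t : ℝ => (((1 + t * c.re) ^ 2 + (t * c.im) ^ 2 : ℝ) : ℂ) * lagrProd F p := by
    ext t
    have : p + t • ((0, c • p.2) : Cn n × Cn n) = (p.1, (1 + t * c : ℂ) • p.2) := by
      apply Prod.ext
      · simp
      · ext i; simp; ring
    simp only [Function.comp, this, lagrProd_smul hF]
    congr 2
    rw [← Complex.normSq_eq_norm_sq, Complex.normSq_apply]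
    simp; ring
  rw [h2] at h1
  have h3 : HasDerivAt (fun t : ℝ => (1 + t * c.re) ^ 2 + (t * c.im) ^ 2) (2 * c.re) 0 := by
    have a1 := (((hasDerivAt_id (0 : ℝ)).mul_const c.re).const_add 1).pow 2
    have a2 := ((hasDerivAt_id (0 : ℝ)).mul_const c.im).pow 2
    exact (a1.add a2).congr_deriv (by simp)
  exact h1.unique (h3.ofReal_comp.mul_const _)

lemma del_lagrProd_fibre (hF : IsHomogeneous F) (hd : DifferentiableAt ℝ (lagrProd F) p) :
    del (0, p.2) (lagrProd F) p = lagrProd F p := by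
  have h1 := fderiv_lagrProd_fibre hF hd 1
  have h2 := fderiv_lagrProd_fibre hF hd Complex.I
  have e : Complex.I • ((0, p.2) : Cn n × Cn n) = (0, Complex.I • p.2) := by simp
  rw [one_smul] at h1
  rw [del, e, h1, h2]; simp

lemma euler_del (hF : IsHomogeneous F) (hd : DifferentiableAt ℝ (lagrProd F) p) :
    ∑ k, p.2 k * del (ev k) (lagrProd F) p = lagrProd F p := by
  rw [← del_lagrProd_fibre hF hd, ← sum_smul_ev, del_sum_dir]
  simp only [del_smul_dir]

lemma conj_lagrProd : conj (lagrProd F p) = lagrProd F p := Complex.conj_ofReal _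

lemma euler_dbar (hF : IsHomogeneous F) (hd : DifferentiableAt ℝ (lagrProd F) p) :
    ∑ k, conj (p.2 k) * dbar (ev k) (lagrProd F) p = lagrProd F p := by
  have := congrArg conj (euler_del hF hd)
  simpa only [map_sum, map_mul, ← dbar_lagrProd, conj_lagrProd] using this

variable (hU : IsOpen U) (hL : ContDiffOn ℝ ∞ (lagrProd F) U) (hp : p ∈ U)
include hU hL hp

lemma fund_eq (i j : Fin n) :
    fund F p.1 p.2 i j = del (ev i) (dbar (ev j) (lagrProd F)) p := by
  simp only [fund, Matrix.of_apply]
  refine dEta_eq_del hU (fun q hq => ?_) hp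
    (differentiableAt_of_contDiffOn hU (contDiffOn_dbar hU hL) hp) i
  exact dEtaBar_eq_dbar hU (fun _ _ => rfl) hq (differentiableAt_of_contDiffOn hU hL hq) j

end Homogeneous

/-! ### Spray, torsion and `θ*` expressed by derivatives of `L`. -/

section ChernFinsler

variable {n : ℕ} {F : Cn n → Cn n → ℝ} {U : Set (Cn n × Cn n)} {p : Cn n × Cn n}
variable (hF : IsHomogeneous F) (hU : IsOpen U) (hL : ContDiffOn ℝ ∞ (lagrProd F) U) (hp : p ∈ U)

include hU hL hp in
lemma dz_fund (i j k : Fin n) : dz k (fun z η => fund F z η i j) p.1 p.2 =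
    del (ez k) (del (ev i) (dbar (ev j) (lagrProd F))) p :=
  dz_eq_del hU (fun _ hq => fund_eq hU hL hq i j) hp
    (differentiableAt_of_contDiffOn hU (contDiffOn_del hU (contDiffOn_dbar hU hL)) hp) k

include hU hL hp in
lemma dEta_fund (i j k : Fin n) : dEta k (fun z η => fund F z η i j) p.1 p.2 =
    del (ev k) (del (ev i) (dbar (ev j) (lagrProd F))) p :=
  dEta_eq_del hU (fun _ hq => fund_eq hU hL hq i j) hp
    (differentiableAt_of_contDiffOn hU (contDiffOn_del hU (contDiffOn_dbar hU hL)) hp) k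

include hF hU hL in
-- Obtained by applying `∂/∂ηⁱ` to Euler's identity in `η̄`, whose coefficients `η̄ʲ` are constants
-- for that operator.
lemma fund_contract_bar (i : Fin n) :
    Set.EqOn (fun q => ∑ j, conj (q.2 j) * del (ev i) (dbar (ev j) (lagrProd F)) q)
      (del (ev i) (lagrProd F)) U := by
  intro q hq
  have h1 : del (ev i) (fun q : Cn n × Cn n => ∑ k, conj (q.2 k) * dbar (ev k) (lagrProd F) q) q =
      del (ev i) (lagrProd F) q :=
    del_congr_of_eqOn hU
      (fun r hr => euler_dbar hF (differentiableAt_of_contDiffOn hU hL hr)) hq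
  have hd : ∀ k, DifferentiableAt ℝ (dbar (ev k) (lagrProd F)) q := fun k =>
    differentiableAt_of_contDiffOn hU (contDiffOn_dbar hU hL) hq
  rw [del_sum fun k _ => (differentiableAt_real_conj_snd_apply k).fun_mul (hd k)] at h1
  simp only [del_mul (differentiableAt_real_conj_snd_apply _) (hd _), del_conj_snd_apply,
    mul_zero, add_zero] at h1
  exact h1

include hF hU hL in
lemma fund_contract (j : Fin n) :
    Set.EqOn (fun q => ∑ i, q.2 i * del (ev i) (dbar (ev j) (lagrProd F)) q)
      (dbar (ev j) (lagrProd F)) U := by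
  intro q hq
  have h1 : dbar (ev j) (fun q : Cn n × Cn n => ∑ k, q.2 k * del (ev k) (lagrProd F) q) q =
      dbar (ev j) (lagrProd F) q :=
    dbar_congr_of_eqOn hU
      (fun r hr => euler_del hF (differentiableAt_of_contDiffOn hU hL hr)) hq
  have hd : ∀ k, DifferentiableAt ℝ (del (ev k) (lagrProd F)) q := fun k =>
    differentiableAt_of_contDiffOn hU (contDiffOn_del hU hL) hq
  rw [dbar_sum fun k _ => (differentiableAt_real_snd_apply k).fun_mul (hd k)] at h1
  simp only [dbar_mul (differentiableAt_real_snd_apply _) (hd _), dbar_snd_apply,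
    mul_zero, add_zero, ← del_dbar_comm hU hL hq] at h1
  exact h1

include hF hU hL hp in
-- Differentiating `ηᵏ ∂L/∂ηᵏ = L` in `ηⁱ`, the product-rule term `∂L/∂ηⁱ` cancels the right-hand
-- side.
lemma hessian_contract (i : Fin n) :
    ∑ j, p.2 j * del (ev i) (del (ev j) (lagrProd F)) p = 0 := by
  have h1 : del (ev i) (fun q : Cn n × Cn n => ∑ k, q.2 k * del (ev k) (lagrProd F) q) p =
      del (ev i) (lagrProd F) p :=
    del_congr_of_eqOn hU
      (fun r hr => euler_del hF (differentiableAt_of_contDiffOn hU hL hr)) hp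
  have hd : ∀ k, DifferentiableAt ℝ (del (ev k) (lagrProd F)) p := fun k =>
    differentiableAt_of_contDiffOn hU (contDiffOn_del hU hL) hp
  rw [del_sum fun k _ => (differentiableAt_real_snd_apply k).fun_mul (hd k)] at h1
  simp only [del_mul (differentiableAt_real_snd_apply _) (hd _), del_snd_apply,
    Finset.sum_add_distrib] at h1
  simpa [ev, Pi.single_apply] using h1

include hU hL hp in
lemma dbar_lagrFlow (m : Fin n) : dbar (ev m) (lagrFlow F) p =
    ∑ j, p.2 j * del (ez j) (dbar (ev m) (lagrProd F)) p := by
  have hd : ∀ k, DifferentiableAt ℝ (del (ez k) (lagrProd F)) p := fun k =>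
    differentiableAt_of_contDiffOn hU (contDiffOn_del hU hL) hp
  have h1 : dbar (ev m) (lagrFlow F) p = _ :=
    dbar_sum fun k _ => (differentiableAt_real_snd_apply k).fun_mul (hd k)
  rw [h1]
  simp only [dbar_mul (differentiableAt_real_snd_apply _) (hd _), dbar_snd_apply,
    mul_zero, add_zero, del_dbar_comm hU hL hp]

include hU hL hp in
lemma del_lagrFlow (m : Fin n) : del (ev m) (lagrFlow F) p =
    ∑ j, p.2 j * del (ez j) (del (ev m) (lagrProd F)) p + del (ez m) (lagrProd F) p := by
  have hd : ∀ k, DifferentiableAt ℝ (del (ez k) (lagrProd F)) p := fun k =>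
    differentiableAt_of_contDiffOn hU (contDiffOn_del hU hL) hp
  have h1 : del (ev m) (lagrFlow F) p = _ :=
    del_sum fun k _ => (differentiableAt_real_snd_apply k).fun_mul (hd k)
  rw [h1]
  simp only [del_mul (differentiableAt_real_snd_apply _) (hd _), del_snd_apply,
    Finset.sum_add_distrib, del_del_comm hU hL hp (u := ev m)]
  simp [ev, Pi.single_apply]

include hF hU hL hp in
-- The factor `ηˡ` passes inside `∂/∂zʲ`, where `g_{l m̄} ηˡ = ∂L/∂η̄ᵐ`.
lemma nonlinConn_eq (i j : Fin n) : nonlinConn F i j p.1 p.2 =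
    ∑ m, fundInv F p.1 p.2 m i * del (ez j) (dbar (ev m) (lagrProd F)) p := by
  have hd : ∀ i m, DifferentiableAt ℝ (del (ev i) (dbar (ev m) (lagrProd F))) p := fun i m =>
    differentiableAt_of_contDiffOn hU (contDiffOn_del hU (contDiffOn_dbar hU hL)) hp
  unfold nonlinConn
  refine Finset.sum_congr rfl fun m _ => ?_
  have h := del_congr_of_eqOn (u := ez j) hU (fund_contract hF hU hL m) hp
  rw [del_sum fun k _ => (differentiableAt_real_snd_apply k).fun_mul (hd k m)] at h
  simp only [del_mul (differentiableAt_real_snd_apply _) (hd _ _), del_snd_apply] at h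
  rw [← h, Finset.mul_sum]
  refine Finset.sum_congr rfl fun l _ => ?_
  rw [dz_fund hU hL hp]
  simp only [ez, Pi.zero_apply, mul_zero, add_zero]
  ring

section Invertible

variable (hdet : (fund F p.1 p.2).det ≠ 0)

include hdet in
lemma fund_mul_fundInv (m m' : Fin n) :
    ∑ k, fund F p.1 p.2 k m' * fundInv F p.1 p.2 m k = if m = m' then 1 else 0 := by
  have h := Matrix.nonsing_inv_mul (fund F p.1 p.2) (isUnit_iff_ne_zero.mpr hdet)
  have h2 := congrFun (congrFun h m) m'
  rw [Matrix.mul_apply, Matrix.one_apply] at h2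
  rw [← h2]
  exact Finset.sum_congr rfl fun k _ => mul_comm _ _

include hdet in
lemma fund_lower (c : Fin n → ℂ) (m' : Fin n) :
    ∑ k, fund F p.1 p.2 k m' * ∑ m, fundInv F p.1 p.2 m k * c m = c m' := by
  simp only [Finset.mul_sum]
  rw [Finset.sum_comm]
  simp only [← mul_assoc, ← Finset.sum_mul, fund_mul_fundInv hdet]
  simp

include hdet in
lemma eq_zero_of_fund_lower {v : Fin n → ℂ} (h : ∀ m, ∑ k, fund F p.1 p.2 k m * v k = 0) :
    v = 0 := by
  by_contra hv
  refine hdet (Matrix.exists_vecMul_eq_zero_iff.mp ⟨v, hv, ?_⟩)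
  ext m
  simpa [Matrix.vecMul, dotProduct, mul_comm] using h m

include hF hU hL hp hdet in
/-- The spray lowered with the fundamental tensor. -/
lemma fund_spray (m : Fin n) : ∑ k, fund F p.1 p.2 k m * (2 * spray F k p.1 p.2) =
    dbar (ev m) (lagrFlow F) p := by
  rw [dbar_lagrFlow hU hL hp]
  rw [← fund_lower hdet (fun m => ∑ j, p.2 j * del (ez j) (dbar (ev m) (lagrProd F)) p) m]
  refine Finset.sum_congr rfl fun k _ => ?_
  congr 1
  simp only [spray, nonlinConn_eq hF hU hL hp, Finset.mul_sum, Finset.sum_mul]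
  rw [Finset.sum_comm]
  refine Finset.sum_congr rfl fun m _ => Finset.sum_congr rfl fun j _ => ?_
  ring

include hF hU hL hp in
-- Since `∂L/∂ηᵏ = g_{k m̄} η̄ᵐ`, contracting with `∂L/∂η` means lowering the index and pairing with
-- `η̄`. It turns each lowered formula below into a scalar one.
lemma del_contract (v : Fin n → ℂ) : ∑ k, del (ev k) (lagrProd F) p * v k =
    ∑ m, conj (p.2 m) * ∑ k, fund F p.1 p.2 k m * v k := by
  simp only [← fund_contract_bar hF hU hL _ hp, Finset.mul_sum, Finset.sum_mul,
    fund_eq hU hL hp]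
  rw [Finset.sum_comm]
  refine Finset.sum_congr rfl fun m _ => Finset.sum_congr rfl fun j _ => ?_
  ring

include hF hU hL hp hdet in
-- The lowered spray is `ηʲ ∂²L/∂zʲ∂η̄ᵐ`; pairing it with `η̄ᵐ` undoes the `η̄`-derivative by
-- Euler's identity.
lemma del_contract_spray : ∑ k, del (ev k) (lagrProd F) p * (2 * spray F k p.1 p.2) =
    lagrFlow F p := by
  rw [del_contract hF hU hL hp]
  simp only [fund_spray hF hU hL hp hdet, dbar_lagrFlow hU hL hp, Finset.mul_sum]
  rw [Finset.sum_comm, lagrFlow]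
  refine Finset.sum_congr rfl fun j _ => ?_
  have hd : ∀ k, DifferentiableAt ℝ (dbar (ev k) (lagrProd F)) p := fun k =>
    differentiableAt_of_contDiffOn hU (contDiffOn_dbar hU hL) hp
  have h1 : del (ez j) (fun q : Cn n × Cn n => ∑ k, conj (q.2 k) * dbar (ev k) (lagrProd F) q) p =
      del (ez j) (lagrProd F) p :=
    del_congr_of_eqOn hU
      (fun r hr => euler_dbar hF (differentiableAt_of_contDiffOn hU hL hr)) hp
  rw [del_sum fun k _ => (differentiableAt_real_conj_snd_apply k).fun_mul (hd k)] at h1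
  simp only [del_mul (differentiableAt_real_conj_snd_apply _) (hd _), del_conj_snd_apply,
    mul_zero, add_zero] at h1
  rw [← h1, Finset.mul_sum]
  refine Finset.sum_congr rfl fun m _ => ?_
  ring

include hF hU hL hp hdet in
lemma del_contract_hCoeff (j k : Fin n) :
    ∑ i, del (ev i) (lagrProd F) p * hCoeff F i j k p.1 p.2 =
      del (ez k) (del (ev j) (lagrProd F)) p -
        ∑ r, nonlinConn F r k p.1 p.2 * del (ev r) (del (ev j) (lagrProd F)) p := by
  have hd : ∀ i m, DifferentiableAt ℝ (del (ev i) (dbar (ev m) (lagrProd F))) p := fun i m =>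
    differentiableAt_of_contDiffOn hU (contDiffOn_del hU (contDiffOn_dbar hU hL)) hp
  have key : ∀ u, del u (del (ev j) (lagrProd F)) p =
      ∑ m, conj (p.2 m) * del u (del (ev j) (dbar (ev m) (lagrProd F))) p := fun u => by
    rw [← del_congr_of_eqOn hU (fund_contract_bar hF hU hL j) hp,
      del_sum fun k _ => (differentiableAt_real_conj_snd_apply k).fun_mul (hd j k)]
    simp only [del_mul (differentiableAt_real_conj_snd_apply _) (hd _ _), del_conj_snd_apply,
      mul_zero, add_zero]
  rw [del_contract hF hU hL hp]
  simp only [hCoeff, fund_lower hdet (fun l => hDeriv F k (fun z η => fund F z η j l) p.1 p.2)]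
  simp only [hDeriv, dz_fund hU hL hp, dEta_fund hU hL hp, key, mul_sub, Finset.sum_sub_distrib,
    Finset.mul_sum]
  congr 1
  rw [Finset.sum_comm]
  refine Finset.sum_congr rfl fun m _ => Finset.sum_congr rfl fun j _ => ?_
  ring

include hF hU hL hp hdet in
/-- The contracted torsion in terms of derivatives of the Lagrangian. -/
lemma del_contract_torsion (m : Fin n) :
    ∑ i, del (ev i) (lagrProd F) p * ∑ j, torsion F i j m p.1 p.2 * p.2 j =
      2 * del (ez m) (lagrProd F) p - del (ev m) (lagrFlow F) p +
        ∑ r, 2 * spray F r p.1 p.2 * del (ev r) (del (ev m) (lagrProd F)) p := by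
  have e1 : ∑ i, del (ev i) (lagrProd F) p * ∑ j, torsion F i j m p.1 p.2 * p.2 j =
      ∑ j, p.2 j * (∑ i, del (ev i) (lagrProd F) p * hCoeff F i j m p.1 p.2) -
      ∑ j, p.2 j * (∑ i, del (ev i) (lagrProd F) p * hCoeff F i m j p.1 p.2) := by
    simp only [torsion, Finset.mul_sum, ← Finset.sum_sub_distrib]
    rw [Finset.sum_comm]
    refine Finset.sum_congr rfl fun m _ => Finset.sum_congr rfl fun j _ => ?_
    ring
  -- Euler's identity differentiated in the base direction `zᵐ`.
  have e2 : ∑ j, p.2 j * del (ez m) (del (ev j) (lagrProd F)) p = del (ez m) (lagrProd F) p := by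
    have hd : ∀ k, DifferentiableAt ℝ (del (ev k) (lagrProd F)) p := fun k =>
      differentiableAt_of_contDiffOn hU (contDiffOn_del hU hL) hp
    have h1 : del (ez m) (fun q : Cn n × Cn n => ∑ k, q.2 k * del (ev k) (lagrProd F) q) p =
        del (ez m) (lagrProd F) p :=
      del_congr_of_eqOn hU
        (fun r hr => euler_del hF (differentiableAt_of_contDiffOn hU hL hr)) hp
    rw [del_sum fun k _ => (differentiableAt_real_snd_apply k).fun_mul (hd k)] at h1
    simp only [del_mul (differentiableAt_real_snd_apply _) (hd _), del_snd_apply] at h1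
    simpa [ez] using h1
  -- The holomorphic Hessian of `L` annihilates `η`, so the vertical part of `δ_m` contributes
  -- nothing here; in `e4` the contraction falls on the connection instead and produces the spray.
  have e3 : ∑ j, p.2 j * ∑ r, nonlinConn F r m p.1 p.2 * del (ev r) (del (ev j) (lagrProd F)) p
      = 0 := by
    simp only [Finset.mul_sum]
    rw [Finset.sum_comm]
    refine Finset.sum_eq_zero fun r _ => ?_
    rw [← mul_zero (nonlinConn F r m p.1 p.2), ← hessian_contract hF hU hL hp r, Finset.mul_sum]
    refine Finset.sum_congr rfl fun j _ => ?_
    ring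
  have e4 : ∑ j, p.2 j * ∑ r, nonlinConn F r j p.1 p.2 * del (ev r) (del (ev m) (lagrProd F)) p
      = ∑ r, 2 * spray F r p.1 p.2 * del (ev r) (del (ev m) (lagrProd F)) p := by
    simp only [spray, Finset.mul_sum, Finset.sum_mul]
    rw [Finset.sum_comm]
    refine Finset.sum_congr rfl fun m _ => Finset.sum_congr rfl fun j _ => ?_
    ring
  rw [e1]
  simp only [del_contract_hCoeff hF hU hL hp hdet, mul_sub, Finset.sum_sub_distrib]
  rw [e2, e3, e4, del_lagrFlow hU hL hp]
  ring

include hF hU hL hp hdet in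
/-- `θ*` lowered with the fundamental tensor. -/
lemma fund_thetaStar (m : Fin n) : ∑ k, fund F p.1 p.2 k m * thetaStar F k p.1 p.2 =
    conj (∑ i, del (ev i) (lagrProd F) p * ∑ j, torsion F i j m p.1 p.2 * p.2 j) := by
  rw [← fund_lower hdet
    (fun m => conj (∑ i, del (ev i) (lagrProd F) p * ∑ j, torsion F i j m p.1 p.2 * p.2 j)) m]
  refine Finset.sum_congr rfl fun k _ => ?_
  congr 1
  unfold thetaStar
  refine Finset.sum_congr rfl fun m _ => ?_
  simp only [map_sum, map_mul, ← dbar_lagrProd, ← fund_contract hF hU hL _ hp, ← fund_eq hU hL hp,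
    Finset.sum_mul, Finset.mul_sum]
  rw [Finset.sum_comm]
  refine Finset.sum_congr rfl fun i _ => ?_
  rw [Finset.sum_comm]
  refine Finset.sum_congr rfl fun j _ => Finset.sum_congr rfl fun l _ => ?_
  ring

include hF hU hL hp hdet in
-- Both lower indices of the torsion end up contracted with the same vector `η`, and the torsion is
-- antisymmetric in them.
lemma del_contract_thetaStar : ∑ k, del (ev k) (lagrProd F) p * thetaStar F k p.1 p.2 = 0 := by
  rw [del_contract hF hU hL hp]
  simp only [fund_thetaStar hF hU hL hp hdet, ← map_mul, ← map_sum]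
  rw [map_eq_zero]
  simp only [Finset.mul_sum]
  rw [Finset.sum_comm]
  refine Finset.sum_eq_zero fun i _ => ?_
  have h : ∀ s : ℂ, s = -s → s = 0 := fun s hs => self_eq_neg.mp hs
  apply h
  conv_rhs => rw [Finset.sum_comm]
  rw [← Finset.sum_neg_distrib]
  refine Finset.sum_congr rfl fun j _ => ?_
  rw [← Finset.sum_neg_distrib]
  refine Finset.sum_congr rfl fun l _ => ?_
  simp only [torsion]
  ring

end Invertible

end ChernFinsler

/-! ### Metrics independent of the base point to first order. -/

variable {n : ℕ} {D : Set (Cn n)} {F F' : Cn n → Cn n → ℝ} {p : Cn n × Cn n}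

/-- The regular points of `F` over `D`. -/
def regSet (D : Set (Cn n)) (F : Cn n → Cn n → ℝ) : Set (Cn n × Cn n) :=
  {p | p.1 ∈ D ∧ IsRegular F p.1 p.2}

lemma isOpen_regSet (hD : IsOpen D) : IsOpen (regSet D F) := by
  rw [isOpen_iff_mem_nhds]
  rintro ⟨z, η⟩ ⟨hz, hη, hs⟩
  have h1 : ∀ᶠ q : Cn n × Cn n in 𝓝 (z, η), q.1 ∈ D :=
    continuousAt_fst.preimage_mem_nhds (hD.mem_nhds hz)
  have h2 : ∀ᶠ q : Cn n × Cn n in 𝓝 (z, η), q.2 ≠ 0 :=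
    continuousAt_snd.preimage_mem_nhds (isOpen_ne.mem_nhds hη)
  filter_upwards [h1, h2, hs.eventually_nhds] with q a b c using ⟨a, b, c⟩

lemma contDiffOn_lagrProd : ContDiffOn ℝ ∞ (lagrProd F) (regSet D F) := by
  rintro ⟨z, η⟩ ⟨_, _, hs⟩
  exact (Complex.ofRealCLM.contDiff.contDiffAt.comp _ hs.self_of_nhds).contDiffWithinAt

/-- The Lagrangian does not vary with the base point, infinitesimally, at the regular points. -/
def IsStationary (D : Set (Cn n)) (F : Cn n → Cn n → ℝ) : Prop :=
  ∀ p ∈ regSet D F, ∀ k, del (ez k) (lagrProd F) p = 0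

namespace IsStationary

variable (hD : IsOpen D) (h : IsStationary D F)
include hD h

lemma dz_fund (hp : p ∈ regSet D F) (i j k : Fin n) :
    dz k (fun z η => fund F z η i j) p.1 p.2 = 0 := by
  have hU := isOpen_regSet (F := F) hD
  have hL := contDiffOn_lagrProd (D := D) (F := F)
  rw [ComplexFinsler.dz_fund hU hL hp, del_del_comm hU (contDiffOn_dbar hU hL) hp]
  have : Set.EqOn (del (ez k) (dbar (ev j) (lagrProd F))) (fun _ => 0) (regSet D F) := by
    intro q hq
    rw [del_dbar_comm hU hL hq, dbar_congr_of_eqOn (g := fun _ => 0) hU (fun r hr => h r hr k) hq,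
      dbar_const]
  rw [del_congr_of_eqOn hU this hp, del_const]

lemma nonlinConn (hp : p ∈ regSet D F) (i j : Fin n) : nonlinConn F i j p.1 p.2 = 0 := by
  simp [ComplexFinsler.nonlinConn, h.dz_fund hD hp]

lemma spray (hp : p ∈ regSet D F) (i : Fin n) : spray F i p.1 p.2 = 0 := by
  simp [ComplexFinsler.spray, h.nonlinConn hD hp]

lemma torsion (hp : p ∈ regSet D F) (i j k : Fin n) : torsion F i j k p.1 p.2 = 0 := by
  simp [ComplexFinsler.torsion, hCoeff, hDeriv, h.nonlinConn hD hp, h.dz_fund hD hp]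

lemma thetaStar (hp : p ∈ regSet D F) (i : Fin n) : thetaStar F i p.1 p.2 = 0 := by
  simp [ComplexFinsler.thetaStar, h.torsion hD hp]

lemma isComplexBerwald : IsComplexBerwald D F := by
  refine ⟨fun z hz η hη i k => ?_, fun z hz η hη i m => ?_⟩
  · exact Finset.sum_eq_zero fun j _ => by rw [h.torsion hD (p := (z, η)) ⟨hz, hη⟩, zero_mul]
  · have := dEtaBar_eq_dbar (f := ComplexFinsler.spray F i) (g := fun _ => 0) (p := (z, η))
      (isOpen_regSet hD) (fun q hq => h.spray hD hq i) ⟨hz, hη⟩ (differentiableAt_const _) m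
    simpa using this

/-- Both geodesic equations reduce to `z'' = 0`, so the identity change of parameter suffices. -/
lemma geodesicsReparametrize (h' : IsStationary D F') : GeodesicsReparametrize D F F' := by
  intro I z hz hadm
  refine ⟨id, z, contDiffOn_id, fun s _ => by simp, ?_, fun _ _ => rfl⟩
  rw [Set.image_id]
  refine ⟨hz.isOpen, hz.ordConnected, hz.contDiffOn, hz.mem, hadm, fun s hs i => ?_⟩
  have e := hz.eqn s hs i
  have m : (z s, deriv z s) ∈ regSet D F := ⟨hz.mem s hs, hz.admissible s hs⟩
  have m' : (z s, deriv z s) ∈ regSet D F' := ⟨hz.mem s hs, hadm s hs⟩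
  have e1 := h.spray hD m i
  have e2 := h.thetaStar hD m i
  have e3 := h'.spray hD m' i
  have e4 := h'.thetaStar hD m' i
  simp only at e1 e2 e3 e4
  rw [e1, e2] at e
  rw [e3, e4, e]

lemma projectivelyRelated (h' : IsStationary D F') : ProjectivelyRelated D F F' :=
  ⟨h.geodesicsReparametrize hD h', h'.geodesicsReparametrize hD h⟩

end IsStationary

/-! ### The Euclidean metric. -/

section Euclidean

lemma euclideanMetric_sq (z η : Cn n) : euclideanMetric z η ^ 2 = ∑ i, ‖η i‖ ^ 2 :=
  Real.sq_sqrt (Finset.sum_nonneg fun _ _ => sq_nonneg _)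

lemma isRegular_euclideanMetric (z : Cn n) {η : Cn n} (hη : η ≠ 0) :
    IsRegular euclideanMetric z η := by
  refine ⟨hη, Filter.Eventually.of_forall fun q => ContDiff.contDiffAt ?_⟩
  simp only [euclideanMetric_sq]
  refine ContDiff.sum fun i _ => ContDiff.norm_sq ℝ ?_
  fun_prop

lemma isStationary_euclideanMetric (hD : IsOpen D) : IsStationary D euclideanMetric := by
  intro p hp k
  have hd := differentiableAt_of_contDiffOn (isOpen_regSet hD) contDiffOn_lagrProd hp
  rw [ez, ← del_slice_left hd]
  simp only [lagrProd, lagr, euclideanMetric_sq, del_const]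

end Euclidean

/-! ### Stationarity of a metric whose geodesics include the straight lines. -/

section Projective

/-- If straight lines can be reparametrized as geodesics of `F`, the geodesic acceleration of `F` is
a real multiple of the velocity. -/
lemma GeodesicsReparametrize.exists_spray_eq (hD : IsOpen D)
    (h : GeodesicsReparametrize D euclideanMetric F) (hp : p ∈ regSet D F) :
    ∃ c : ℝ, 0 < c ∧ ∃ P : ℝ, ∀ i, 2 * spray F i p.1 ((c : ℂ) • p.2) -
      thetaStar F i p.1 ((c : ℂ) • p.2) = (P : ℂ) * ((c : ℂ) • p.2) i := by
  set z : ℝ → Cn n := fun s => p.1 + s • p.2 with hz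
  have hdz : ∀ s, HasDerivAt z p.2 s := fun s => by
    simpa [hz] using ((hasDerivAt_id s).smul_const p.2).const_add p.1
  have hdz' : deriv z = fun _ => p.2 := funext fun s => (hdz s).deriv
  have hcont : Continuous fun s : ℝ => (z s, p.2) := by
    simp only [hz]; fun_prop
  have hopen := (isOpen_regSet (F := F) hD).preimage hcont
  have h0 : (0 : ℝ) ∈ (fun s : ℝ => (z s, p.2)) ⁻¹' regSet D F := by simpa [hz] using hp
  -- Regular points form an open set, so a short segment of the line stays over `D` and is
  -- admissible for `F`.
  obtain ⟨ε, hε, hball⟩ := Metric.isOpen_iff.mp hopen 0 h0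
  rw [Real.ball_eq_Ioo, zero_sub, zero_add] at hball
  have h0I : (0 : ℝ) ∈ Set.Ioo (-ε) ε := ⟨by linarith, hε⟩
  have hgeo : IsComplexGeodesic D euclideanMetric (Set.Ioo (-ε) ε) z := by
    refine ⟨isOpen_Ioo, Set.ordConnected_Ioo, ?_, fun s hs => (hball hs).1, fun s hs => ?_,
      fun s hs i => ?_⟩
    · exact ContDiff.contDiffOn (by simp only [hz]; fun_prop)
    · rw [hdz']; exact isRegular_euclideanMetric _ hp.2.1
    · have m : (z s, p.2) ∈ regSet D euclideanMetric :=
        ⟨(hball hs).1, isRegular_euclideanMetric _ hp.2.1⟩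
      have e1 := (isStationary_euclideanMetric hD).spray hD m i
      have e2 := (isStationary_euclideanMetric hD).thetaStar hD m i
      simp only at e1 e2
      simp only [hdz', e1, e2]
      simp
  obtain ⟨φ, w, hφ, hφpos, hw, hwz⟩ := h _ z hgeo fun s hs => by
    rw [hdz']; exact (hball hs).2
  have hI : IsOpen (Set.Ioo (-ε) ε) := isOpen_Ioo
  have hφd : ∀ s ∈ Set.Ioo (-ε) ε, HasDerivAt φ (deriv φ s) s := fun s hs =>
    ((hφ.contDiffAt (hI.mem_nhds hs)).differentiableAt (by norm_num)).hasDerivAt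
  have hφd2 : HasDerivAt (deriv φ) (deriv (deriv φ) 0) 0 :=
    (((hφ.deriv_of_isOpen hI (m := 1) (by norm_num)).contDiffAt
      (hI.mem_nhds h0I)).differentiableAt (by norm_num)).hasDerivAt
  have hwd : ∀ t ∈ φ '' Set.Ioo (-ε) ε, HasDerivAt w (deriv w t) t := fun s hs =>
    ((hw.contDiffOn.contDiffAt (hw.isOpen.mem_nhds hs)).differentiableAt (by norm_num)).hasDerivAt
  have hwd2 : HasDerivAt (deriv w) (deriv (deriv w) (φ 0)) (φ 0) :=
    (((hw.contDiffOn.deriv_of_isOpen hw.isOpen (m := 1) (by norm_num)).contDiffAt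
      (hw.isOpen.mem_nhds ⟨0, h0I, rfl⟩)).differentiableAt (by norm_num)).hasDerivAt
  -- From `w ∘ φ = z`: the new velocity is a positive multiple of the old, which is the source of
  -- the factor `c`.
  have key : ∀ s ∈ Set.Ioo (-ε) ε, deriv w (φ s) = (deriv φ s)⁻¹ • p.2 := by
    intro s hs
    have h1 := (hwd (φ s) ⟨s, hs, rfl⟩).scomp s (hφd s hs)
    have h2 : w ∘ φ =ᶠ[𝓝 s] z := by
      filter_upwards [hI.mem_nhds hs] with t ht using hwz t ht
    have h3 := h1.unique ((hdz s).congr_of_eventuallyEq h2)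
    rw [← h3, smul_smul, inv_mul_cancel₀ (hφpos s hs).ne', one_smul]
  have key2 : deriv φ 0 • deriv (deriv w) (φ 0) =
      (-(deriv (deriv φ) 0) / (deriv φ 0) ^ 2) • p.2 := by
    have h1 := hwd2.scomp (0 : ℝ) (hφd 0 h0I)
    have h2 : deriv w ∘ φ =ᶠ[𝓝 0] fun s => (deriv φ s)⁻¹ • p.2 := by
      filter_upwards [hI.mem_nhds h0I] with t ht using key t ht
    exact h1.unique (((hφd2.inv (hφpos 0 h0I).ne').smul_const p.2).congr_of_eventuallyEq h2)
  have hc := hφpos 0 h0I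
  -- Here `w'' = -(φ''/φ'³) η`, and `2G - θ* = -w''` is `φ''/φ'²` times the new velocity `η/φ'`.
  refine ⟨(deriv φ 0)⁻¹, inv_pos.mpr hc, deriv (deriv φ) 0 / (deriv φ 0) ^ 2, fun i => ?_⟩
  have e := hw.eqn (φ 0) ⟨0, h0I, rfl⟩ i
  have hw0 : w (φ 0) = p.1 := by rw [hwz 0 h0I]; simp [hz]
  have hsm : (((deriv φ 0)⁻¹ : ℝ) : ℂ) • p.2 = (deriv φ 0)⁻¹ • p.2 := by ext; simp
  rw [key 0 h0I, hw0] at e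
  rw [hsm]
  have k2 := congrFun key2 i
  simp only [Pi.smul_apply, Complex.real_smul] at k2 ⊢
  have hc' : ((deriv φ 0 : ℝ) : ℂ) ≠ 0 := by exact_mod_cast hc.ne'
  have e5 : deriv (deriv w) (φ 0) i = ((-(deriv (deriv φ) 0) / (deriv φ 0) ^ 2 : ℝ) : ℂ) * p.2 i *
      ((deriv φ 0 : ℝ) : ℂ)⁻¹ := by
    rw [← k2]; field_simp
  rw [e5] at e
  push_cast at e ⊢
  linear_combination e

lemma del_ez_lagrProd_smul (hF : IsHomogeneous F) {z η : Cn n} (c : ℂ)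
    (h1 : DifferentiableAt ℝ (lagrProd F) (z, η)) (h2 : DifferentiableAt ℝ (lagrProd F) (z, c • η))
    (k : Fin n) :
    del (ez k) (lagrProd F) (z, c • η) = (‖c‖ ^ 2 : ℝ) * del (ez k) (lagrProd F) (z, η) := by
  have a1 := del_slice_left h1 (Pi.single k 1)
  have a2 := del_slice_left h2 (Pi.single k 1)
  simp only [lagrProd_smul hF] at a1 a2
  rw [ez, ← a1, ← a2, del_const_mul]
  exact DifferentiableAt.comp (g := lagrProd F) z h1
    (differentiableAt_id.prodMk (differentiableAt_const _))

/-- The factor `c|c|²` is not real for non-real `c`; this is what excludes a nonzero real-valued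
flow. -/
lemma lagrFlow_smul (hF : IsHomogeneous F) {z η : Cn n} (c : ℂ)
    (h1 : DifferentiableAt ℝ (lagrProd F) (z, η)) (h2 : DifferentiableAt ℝ (lagrProd F) (z, c • η)) :
    lagrFlow F (z, c • η) = c * (‖c‖ ^ 2 : ℝ) * lagrFlow F (z, η) := by
  simp only [lagrFlow, del_ez_lagrProd_smul hF c h1 h2, Pi.smul_apply, smul_eq_mul, Finset.mul_sum]
  exact Finset.sum_congr rfl fun j _ => by ring

/-- The core of both directions. It is stated on an open cone `V` of nondegenerate regular points,
because the Randers metric is treated first where `β ≠ 0` and then over the interior of the zero set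
of `b`. Stability under complex scalars is needed for the positive factor coming from
reparametrization and for rotation by `i`. -/
lemma GeodesicsReparametrize.del_lagrProd_eq_zero (hD : IsOpen D) (hF : IsHomogeneous F)
    (h : GeodesicsReparametrize D euclideanMetric F) {V : Set (Cn n × Cn n)} (hVo : IsOpen V)
    (hV : V ⊆ regSet D F)
    (hcone : ∀ q ∈ V, ∀ c : ℂ, c ≠ 0 → (q.1, c • q.2) ∈ V)
    (hdet : ∀ q ∈ V, (fund F q.1 q.2).det ≠ 0) (hpos : ∀ q ∈ V, lagrProd F q ≠ 0)
    (hp : p ∈ V) (k : Fin n) : del (ez k) (lagrProd F) p = 0 := by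
  have hL : ContDiffOn ℝ ∞ (lagrProd F) V := contDiffOn_lagrProd.mono hV
  have hd : ∀ q ∈ V, DifferentiableAt ℝ (lagrProd F) q := fun q hq =>
    differentiableAt_of_contDiffOn hVo hL hq
  have contract : ∀ q ∈ V, ∀ P : ℂ,
      (∀ i, 2 * spray F i q.1 q.2 - thetaStar F i q.1 q.2 = P * q.2 i) →
      lagrFlow F q = P * lagrProd F q := by
    intro q hq P hP
    have e1 := del_contract_spray hF hVo hL hq (hdet q hq)
    have e2 := del_contract_thetaStar hF hVo hL hq (hdet q hq)
    rw [← e1, ← euler_del hF (hd q hq), ← sub_zero (∑ k, _), ← e2, ← Finset.sum_sub_distrib,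
      Finset.mul_sum]
    refine Finset.sum_congr rfl fun i _ => ?_
    rw [← mul_sub, hP]; ring
  -- The multiplier `P` is known only at a positive multiple of `η`; homogeneity carries reality
  -- back to `η`.
  have him : ∀ q ∈ V, (lagrFlow F q).im = 0 := by
    intro q hq
    obtain ⟨c, hc, P, hP⟩ := h.exists_spray_eq hD (hV hq)
    have hc' : (c : ℂ) ≠ 0 := by exact_mod_cast hc.ne'
    have hq' := hcone q hq c hc'
    have e := contract _ hq' P hP
    rw [lagrFlow_smul hF _ (hd q hq) (hd _ hq'), lagrProd, lagr] at e
    have e' := congrArg Complex.im e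
    rw [← Complex.ofReal_mul, ← Complex.ofReal_mul, Complex.ofReal_im, Complex.im_ofReal_mul] at e'
    rcases mul_eq_zero.mp e' with h1 | h1
    · exfalso
      have : 0 < c * ‖(c : ℂ)‖ ^ 2 := by
        have := norm_pos_iff.mpr hc'
        positivity
      linarith
    · exact h1
  -- Reality at `iη` says that `i` times the flow at `η` is real.
  have hflow : ∀ q ∈ V, lagrFlow F q = 0 := by
    intro q hq
    have hq' := hcone q hq Complex.I Complex.I_ne_zero
    have e1 := him _ hq'
    rw [lagrFlow_smul hF _ (hd q hq) (hd _ hq')] at e1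
    exact Complex.ext (by simpa using e1) (him q hq)
  have hspray : ∀ q ∈ V, ∀ i, spray F i q.1 q.2 = 0 := by
    intro q hq i
    have e : (fun k => 2 * spray F k q.1 q.2) = 0 := by
      refine eq_zero_of_fund_lower (hdet q hq) fun m => ?_
      rw [fund_spray hF hVo hL hq (hdet q hq), dbar_congr_of_eqOn (g := fun _ => 0) hVo hflow hq,
        dbar_const]
    simpa using congrFun e i
  obtain ⟨c, hc, P, hP⟩ := h.exists_spray_eq hD (hV hp)
  have hc' : (c : ℂ) ≠ 0 := by exact_mod_cast hc.ne'
  have hq := hcone p hp c hc'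
  set q : Cn n × Cn n := (p.1, (c : ℂ) • p.2) with hqdef
  have hP0 : (P : ℂ) = 0 := by
    have e := contract q hq P hP
    rw [hflow q hq] at e
    exact (mul_eq_zero.mp e.symm).resolve_right (hpos q hq)
  have htheta : ∀ i, thetaStar F i q.1 q.2 = 0 := by
    intro i
    have e1 := hP i
    have e2 := hspray q hq i
    rw [hP0, show spray F i p.1 ((c : ℂ) • p.2) = 0 from e2] at e1
    rw [mul_zero, zero_sub, zero_mul, neg_eq_zero] at e1
    exact e1
  -- With flow and spray zero, the contracted torsion in this formula is `2 ∂L/∂zᵏ`.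
  have e1 := fund_thetaStar hF hVo hL hq (hdet q hq) k
  rw [del_contract_torsion hF hVo hL hq (hdet q hq),
    del_congr_of_eqOn (g := fun _ => 0) hVo hflow hq] at e1
  simp only [htheta, hspray q hq, mul_zero, zero_mul, Finset.sum_const_zero, del_const, sub_zero,
    add_zero] at e1
  have e2 := e1.symm
  rw [map_eq_zero_iff _ (starRingEnd ℂ).injective] at e2
  have e3 : del (ez k) (lagrProd F) q = 0 := by simpa using e2
  rw [hqdef, del_ez_lagrProd_smul hF _ (hd p hp) (hd q hq)] at e3
  refine (mul_eq_zero.mp e3).resolve_left ?_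
  have := norm_ne_zero_iff.mpr hc'
  exact_mod_cast pow_ne_zero 2 this

end Projective

/-! ### Hermitian and linear forms on `ℂⁿ`. -/

section Forms

variable {n : ℕ}

/-- The sesquilinear form with matrix `M`. -/
def sesq (M : Matrix (Fin n) (Fin n) ℂ) (η ξ : Cn n) : ℂ := ∑ i, ∑ j, M i j * η i * conj (ξ j)

/-- The linear form with coefficients `c`. -/
def linForm (c η : Cn n) : ℂ := ∑ i, c i * η i

variable {M : Matrix (Fin n) (Fin n) ℂ} {c η ξ v w : Cn n}

lemma sesq_add_left : sesq M (η + v) ξ = sesq M η ξ + sesq M v ξ := by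
  simp only [sesq, Pi.add_apply, mul_add, add_mul, Finset.sum_add_distrib]

lemma sesq_add_right : sesq M η (ξ + v) = sesq M η ξ + sesq M η v := by
  simp only [sesq, Pi.add_apply, map_add, mul_add, Finset.sum_add_distrib]

lemma sesq_smul_left (t : ℂ) : sesq M (t • η) ξ = t * sesq M η ξ := by
  simp only [sesq, Pi.smul_apply, smul_eq_mul, Finset.mul_sum]
  exact Finset.sum_congr rfl fun _ _ => Finset.sum_congr rfl fun _ _ => by ring

lemma sesq_smul_right (t : ℂ) : sesq M η (t • ξ) = conj t * sesq M η ξ := by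
  simp only [sesq, Pi.smul_apply, smul_eq_mul, map_mul, Finset.mul_sum]
  exact Finset.sum_congr rfl fun _ _ => Finset.sum_congr rfl fun _ _ => by ring

lemma sesq_single (i j : Fin n) : sesq M (Pi.single i 1) (Pi.single j 1) = M i j := by
  unfold sesq
  rw [Finset.sum_eq_single i, Finset.sum_eq_single j]
  · simp
  · intro k _ hk; simp [hk]
  · simp
  · intro k _ hk; simp [hk]
  · simp

lemma conj_sesq (hM : M.IsHermitian) : conj (sesq M η ξ) = sesq M ξ η := by
  simp only [sesq, map_sum, map_mul, Complex.conj_conj]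
  rw [Finset.sum_comm]
  refine Finset.sum_congr rfl fun i _ => Finset.sum_congr rfl fun j _ => ?_
  rw [← hM.apply i j]
  simp only [RCLike.star_def]; ring

lemma sesq_self_eq_re (hM : M.IsHermitian) : ((sesq M η η).re : ℂ) = sesq M η η :=
  Complex.conj_eq_iff_re.mp (conj_sesq hM)

lemma sesq_self_pos (hM : M.PosDef) (hη : η ≠ 0) : 0 < (sesq M η η).re := by
  -- `Matrix.PosDef` concerns `x* M x`, with the conjugate on the left, whereas `sesq` conjugates
  -- its second argument; hence `x = η̄`.
  have h1 : star η ≠ 0 := by simpa using hη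
  have h2 := hM.dotProduct_mulVec_pos h1
  have h3 : star (star η) ⬝ᵥ Matrix.mulVec M (star η) = sesq M η η := by
    simp only [dotProduct, Matrix.mulVec, sesq, Finset.mul_sum, Pi.star_apply,
      RCLike.star_def, Complex.conj_conj]
    exact Finset.sum_congr rfl fun _ _ => Finset.sum_congr rfl fun _ _ => by ring
  rw [h3] at h2
  exact (Complex.pos_iff.mp h2).1

lemma sesq_self_nonneg (hM : M.PosDef) : 0 ≤ (sesq M η η).re := by
  by_cases h : η = 0
  · simp [h, sesq]
  · exact (sesq_self_pos hM h).le

/-- Cauchy–Schwarz: the form is nonnegative at `⟨η,η⟩v - ⟨v,η⟩η`, the component of `v` orthogonal to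
`η` up to scale. -/
lemma norm_sesq_sq_le (hM : M.PosDef) :
    ‖sesq M v η‖ ^ 2 ≤ (sesq M v v).re * (sesq M η η).re := by
  by_cases h : η = 0
  · simp [h, sesq]
  have hp := sesq_self_pos hM h
  have h1 := sesq_self_nonneg (η := (sesq M η η) • v + (-(sesq M v η)) • η) hM
  have h2 : sesq M ((sesq M η η) • v + (-(sesq M v η)) • η)
      ((sesq M η η) • v + (-(sesq M v η)) • η) =
      (((sesq M η η).re * ((sesq M v v).re * (sesq M η η).re - ‖sesq M v η‖ ^ 2) : ℝ) : ℂ) := by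
    simp only [sesq_add_left, sesq_add_right, sesq_smul_left, sesq_smul_right, map_neg]
    push_cast
    rw [← Complex.mul_conj', conj_sesq hM.1, conj_sesq hM.1, sesq_self_eq_re hM.1,
      sesq_self_eq_re hM.1]
    ring
  rw [h2, Complex.ofReal_re] at h1
  have := nonneg_of_mul_nonneg_right h1 hp
  linarith

lemma eq_zero_of_sesq_left (hM : M.PosDef) (h : ∀ w, sesq M v w = 0) : v = 0 := by
  by_contra hv
  have := sesq_self_pos hM hv
  rw [h v] at this
  simp at this

lemma linForm_add : linForm c (η + v) = linForm c η + linForm c v := by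
  simp only [linForm, Pi.add_apply, mul_add, Finset.sum_add_distrib]

lemma linForm_smul (t : ℂ) : linForm c (t • η) = t * linForm c η := by
  simp only [linForm, Pi.smul_apply, smul_eq_mul, Finset.mul_sum]
  exact Finset.sum_congr rfl fun _ _ => by ring

/-- The place where `n ≥ 2` enters: a linear form on a space of dimension at least two has a kernel.
-/
lemma exists_linForm_eq_zero (hn : 2 ≤ n) (c : Cn n) : ∃ u : Cn n, u ≠ 0 ∧ linForm c u = 0 := by
  let ℓ : Cn n →ₗ[ℂ] ℂ :=
    { toFun := linForm c
      map_add' := fun _ _ => linForm_add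
      map_smul' := fun t _ => by simp [linForm_smul] }
  have h : LinearMap.ker ℓ ≠ ⊥ := LinearMap.ker_ne_bot_of_finrank_lt (by simp; omega)
  obtain ⟨u, hu, hu0⟩ := (Submodule.ne_bot_iff _).mp h
  exact ⟨u, hu0, hu⟩

lemma exists_linForm_ne_zero (hc : c ≠ 0) : ∃ v : Cn n, linForm c v ≠ 0 := by
  obtain ⟨i, hi⟩ := Function.ne_iff.mp hc
  exact ⟨Pi.single i 1, by simpa [linForm, Pi.single_apply] using hi⟩

lemma differentiableAt_sesq_left : DifferentiableAt ℂ (fun η => sesq M η ξ) η := by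
  unfold sesq; fun_prop

lemma differentiableAt_real_sesq_left : DifferentiableAt ℝ (fun η => sesq M η ξ) η := by
  unfold sesq; fun_prop

lemma differentiableAt_linForm : DifferentiableAt ℂ (fun η => linForm c η) η := by
  unfold linForm; fun_prop

lemma dbar_sesq_left : dbar v (fun η => sesq M η ξ) η = 0 :=
  dbar_of_differentiableAt differentiableAt_sesq_left

lemma dbar_linForm : dbar v (fun η => linForm c η) η = 0 :=
  dbar_of_differentiableAt differentiableAt_linForm

lemma del_linForm : del v (fun η => linForm c η) η = linForm c v := by
  rw [del_of_differentiableAt differentiableAt_linForm]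
  have h : ∀ i, DifferentiableAt ℂ (fun η : Cn n => c i * η i) η := fun i => by fun_prop
  have h2 : ∀ i, HasFDerivAt (fun η : Cn n => c i * η i)
      (c i • (ContinuousLinearMap.proj (R := ℂ) (φ := fun _ : Fin n => ℂ) i)) η := fun i =>
    (ContinuousLinearMap.proj (R := ℂ) (φ := fun _ : Fin n => ℂ) i).hasFDerivAt.const_mul (c i)
  have h3 := HasFDerivAt.fun_sum (u := Finset.univ) fun i _ => h2 i
  have h4 : HasFDerivAt (fun η => linForm c η) _ η := h3
  rw [h4.fderiv]
  simp [linForm]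

lemma sesq_eq_linForm : sesq M η ξ = linForm (fun i => ∑ j, M i j * conj (ξ j)) η := by
  simp only [sesq, linForm, Finset.sum_mul]
  exact Finset.sum_congr rfl fun _ _ => Finset.sum_congr rfl fun _ _ => by ring

lemma del_sesq_left : del v (fun η => sesq M η ξ) η = sesq M v ξ := by
  simp only [sesq_eq_linForm, del_linForm]

lemma sesq_eq_conj_linForm :
    sesq M η ξ = conj (linForm (fun j => ∑ i, conj (M i j) * conj (η i)) ξ) := by
  simp only [sesq, linForm, Finset.sum_mul, map_sum, map_mul, Complex.conj_conj]
  rw [Finset.sum_comm]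

lemma del_sesq_right : del v (fun ξ => sesq M η ξ) ξ = 0 := by
  simp only [sesq_eq_conj_linForm]
  rw [del_conj, dbar_linForm, map_zero]

lemma dbar_sesq_right : dbar v (fun ξ => sesq M η ξ) ξ = sesq M η v := by
  simp only [sesq_eq_conj_linForm]
  rw [dbar_conj, del_linForm]

lemma differentiableAt_real_sesq_right : DifferentiableAt ℝ (fun ξ => sesq M η ξ) ξ := by
  unfold sesq
  refine DifferentiableAt.fun_sum fun i _ => DifferentiableAt.fun_sum fun j _ => ?_
  refine DifferentiableAt.fun_mul (by fun_prop) ?_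
  exact Complex.conjCLE.differentiableAt.comp ξ (by fun_prop)

lemma differentiableAt_apply_real (i : Fin n) : DifferentiableAt ℝ (fun η : Cn n => η i) η := by
  fun_prop

lemma del_apply (i : Fin n) : del v (fun η : Cn n => η i) η = v i := by
  have := del_linForm (c := Pi.single i 1) (v := v) (η := η)
  simpa [linForm, Pi.single_apply] using this

lemma dbar_apply (i : Fin n) : dbar v (fun η : Cn n => η i) η = 0 := by
  have := dbar_linForm (c := Pi.single i 1) (v := v) (η := η)
  simpa [linForm, Pi.single_apply] using this

lemma sesq_left_eq_sum : sesq M v ξ = ∑ i, v i * sesq M (Pi.single i 1) ξ := by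
  rw [sesq_eq_linForm, linForm]
  refine Finset.sum_congr rfl fun i _ => ?_
  rw [sesq_eq_linForm, linForm]
  simp [Pi.single_apply, mul_comm]

/-- Expanding the left slot in coordinates writes the form as a sum of products of a holomorphic and
an antiholomorphic function, so `del` sees only the first factors. -/
lemma del_sesq_self : del v (fun η => sesq M η η) η = sesq M v η := by
  have h : (fun η => sesq M η η) = fun η => ∑ i, η i * sesq M (Pi.single i 1) η := by
    ext; exact sesq_left_eq_sum
  rw [h, del_sum fun i _ => (differentiableAt_apply_real i).fun_mul differentiableAt_real_sesq_right]
  simp only [del_mul (differentiableAt_apply_real _) differentiableAt_real_sesq_right,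
    del_sesq_right, del_apply, mul_zero, zero_add]
  rw [sesq_left_eq_sum]
  exact Finset.sum_congr rfl fun _ _ => mul_comm _ _

lemma dbar_sesq_self : dbar v (fun η => sesq M η η) η = sesq M η v := by
  have h : (fun η => sesq M η η) = fun η => ∑ i, η i * sesq M (Pi.single i 1) η := by
    ext; exact sesq_left_eq_sum
  rw [h, dbar_sum fun i _ => (differentiableAt_apply_real i).fun_mul differentiableAt_real_sesq_right]
  simp only [dbar_mul (differentiableAt_apply_real _) differentiableAt_real_sesq_right,
    dbar_sesq_right, dbar_apply, mul_zero, add_zero]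
  rw [sesq_left_eq_sum]

end Forms

/-! ### The functions `α²`, `α`, `β`, `|β|` and their smoothness. -/

section Randers

variable {n : ℕ} {D : Set (Cn n)} {a : Cn n → Matrix (Fin n) (Fin n) ℂ} {b : Cn n → Cn n}
  {p : Cn n × Cn n}

/-- The squared Hermitian metric on the product. -/
def sesqProd (a : Cn n → Matrix (Fin n) (Fin n) ℂ) (p : Cn n × Cn n) : ℂ := sesq (a p.1) p.2 p.2

/-- `β` as a function on the product. -/
def linProd (b : Cn n → Cn n) (p : Cn n × Cn n) : ℂ := linForm (b p.1) p.2

/-- `α`, complex valued, on the product. -/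
def hermProd (a : Cn n → Matrix (Fin n) (Fin n) ℂ) (p : Cn n × Cn n) : ℂ :=
  (hermitianMetric a p.1 p.2 : ℝ)

/-- `|β|`, complex valued, on the product. -/
def absProd (b : Cn n → Cn n) (p : Cn n × Cn n) : ℂ := (‖linProd b p‖ : ℝ)

lemma hermitianMetric_eq (z η : Cn n) : hermitianMetric a z η = √(sesqProd a (z, η)).re := rfl

lemma randersMetric_eq (z η : Cn n) :
    randersMetric a b z η = hermitianMetric a z η + ‖linProd b (z, η)‖ := rfl

lemma isHomogeneous_hermitianMetric : IsHomogeneous (hermitianMetric a) := by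
  intro z η c
  simp only [hermitianMetric_eq, sesqProd, sesq_smul_left, sesq_smul_right]
  rw [← mul_assoc, mul_comm (conj c), Complex.mul_conj, Complex.re_ofReal_mul, Complex.normSq_eq_norm_sq,
    Real.sqrt_mul (sq_nonneg _), Real.sqrt_sq (norm_nonneg _)]

lemma isHomogeneous_randersMetric : IsHomogeneous (randersMetric a b) := by
  intro z η c
  simp only [randersMetric_eq, isHomogeneous_hermitianMetric z η c, linProd, linForm_smul, norm_mul]
  ring

variable (hD : IsOpen D) (ha : ∀ i j, ContDiffOn ℝ ∞ (fun z => a z i j) D)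
  (hpos : ∀ z ∈ D, (a z).PosDef) (hb : ContDiffOn ℝ ∞ b D)

lemma contDiffOn_fst_comp {f : Cn n → ℂ} (hf : ContDiffOn ℝ ∞ f D) :
    ContDiffOn ℝ ∞ (fun q : Cn n × Cn n => f q.1) (D ×ˢ Set.univ) :=
  hf.comp contDiffOn_fst fun _ hq => hq.1

lemma contDiff_snd_apply (i : Fin n) : ContDiff ℝ ∞ (fun q : Cn n × Cn n => q.2 i) := by
  fun_prop

include ha in
lemma contDiffOn_sesqProd : ContDiffOn ℝ ∞ (sesqProd a) (D ×ˢ Set.univ) := by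
  unfold sesqProd sesq
  refine ContDiffOn.sum fun i _ => ContDiffOn.sum fun j _ => ?_
  refine ((contDiffOn_fst_comp (ha i j)).mul (contDiff_snd_apply i).contDiffOn).mul ?_
  exact (Complex.conjCLE.contDiff.comp (contDiff_snd_apply j)).contDiffOn

include hb in
lemma contDiffOn_linProd : ContDiffOn ℝ ∞ (linProd b) (D ×ˢ Set.univ) := by
  unfold linProd linForm
  refine ContDiffOn.sum fun i _ => ?_
  exact (contDiffOn_fst_comp ((contDiff_apply ℝ ℂ i).comp_contDiffOn hb)).mul
    (contDiff_snd_apply i).contDiffOn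

include hpos in
lemma sesqProd_re (hp : p.1 ∈ D) : ((sesqProd a p).re : ℂ) = sesqProd a p :=
  sesq_self_eq_re (hpos _ hp).1

include hpos in
lemma hermitianMetric_sq (hp : p.1 ∈ D) : hermitianMetric a p.1 p.2 ^ 2 = (sesqProd a p).re := by
  exact Real.sq_sqrt (sesq_self_nonneg (hpos _ hp))

include hpos in
lemma lagrProd_hermitianMetric (hp : p.1 ∈ D) :
    lagrProd (hermitianMetric a) p = sesqProd a p := by
  rw [lagrProd, lagr, hermitianMetric_sq hpos hp, sesqProd_re hpos hp]

include hpos in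
lemma hermitianMetric_pos (hp : p.1 ∈ D) (hη : p.2 ≠ 0) : 0 < hermitianMetric a p.1 p.2 := by
  rw [hermitianMetric_eq]
  exact Real.sqrt_pos.mpr (sesq_self_pos (hpos _ hp) hη)

include hpos in
lemma fund_hermitianMetric (hp : p.1 ∈ D) : fund (hermitianMetric a) p.1 p.2 = a p.1 := by
  ext i j
  have h : lagr (hermitianMetric a) p.1 = fun η => sesq (a p.1) η η := by
    ext η; exact lagrProd_hermitianMetric (p := (p.1, η)) hpos hp
  have h2 : dEtaBar j (lagr (hermitianMetric a)) p.1 =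
      fun η => sesq (a p.1) η (Pi.single j 1) := by
    ext η
    rw [dEtaBar, wirtBar_eq_dbar, h, dbar_sesq_self]
  rw [fund, Matrix.of_apply, dEta, wirt_eq_del, h2, del_sesq_left, sesq_single]

include hpos in
lemma det_fund_hermitianMetric (hp : p.1 ∈ D) : (fund (hermitianMetric a) p.1 p.2).det ≠ 0 := by
  rw [fund_hermitianMetric hpos hp]
  exact (hpos _ hp).det_pos.ne'

lemma isOpen_prod_ne (hD : IsOpen D) : IsOpen {p : Cn n × Cn n | p.1 ∈ D ∧ p.2 ≠ 0} :=
  (hD.preimage continuous_fst).inter (isOpen_ne.preimage continuous_snd)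

lemma isOpen_prod_univ (hD : IsOpen D) : IsOpen (D ×ˢ (Set.univ : Set (Cn n))) :=
  hD.prod isOpen_univ

include hD ha hpos in
lemma mem_regSet_hermitianMetric (hp : p.1 ∈ D) (hη : p.2 ≠ 0) :
    p ∈ regSet D (hermitianMetric a) := by
  refine ⟨hp, hη, ?_⟩
  filter_upwards [(isOpen_prod_univ hD).mem_nhds (⟨hp, trivial⟩ : p ∈ D ×ˢ Set.univ)] with q hq
  have h1 : ContDiffAt ℝ ∞ (fun q => (sesqProd a q).re) q :=
    Complex.reCLM.contDiff.contDiffAt.comp q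
      ((contDiffOn_sesqProd ha).contDiffAt ((isOpen_prod_univ hD).mem_nhds hq))
  refine h1.congr_of_eventuallyEq ?_
  filter_upwards [(isOpen_prod_univ hD).mem_nhds hq] with r hr
  exact hermitianMetric_sq hpos hr.1

/-- The points where `β` does not vanish. -/
def linNonzero (D : Set (Cn n)) (b : Cn n → Cn n) : Set (Cn n × Cn n) :=
  {p | p.1 ∈ D ∧ linProd b p ≠ 0}

lemma snd_ne_zero_of_mem (hp : p ∈ linNonzero D b) : p.2 ≠ 0 := by
  intro h
  apply hp.2
  simp [linProd, linForm, h]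

include hD hb in
lemma isOpen_linNonzero : IsOpen (linNonzero D b) := by
  have : linNonzero D b = (D ×ˢ Set.univ) ∩ linProd b ⁻¹' {0}ᶜ := by
    ext; simp [linNonzero]
  rw [this]
  exact (contDiffOn_linProd hb).continuousOn.isOpen_inter_preimage (isOpen_prod_univ hD)
    isOpen_compl_singleton

lemma linNonzero_subset : linNonzero D b ⊆ D ×ˢ Set.univ := fun _ hp => ⟨hp.1, trivial⟩

include hD ha hpos in
lemma contDiffOn_hermitianMetric : ContDiffOn ℝ ∞
    (fun q : Cn n × Cn n => hermitianMetric a q.1 q.2) {p : Cn n × Cn n | p.1 ∈ D ∧ p.2 ≠ 0} := by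
  rintro q ⟨hq, hη⟩
  have h1 : ContDiffAt ℝ ∞ (fun q => (sesqProd a q).re) q :=
    Complex.reCLM.contDiff.contDiffAt.comp q
      ((contDiffOn_sesqProd ha).contDiffAt ((isOpen_prod_univ hD).mem_nhds ⟨hq, trivial⟩))
  exact (h1.sqrt (sesq_self_pos (hpos _ hq) hη).ne').contDiffWithinAt

include hD hb in
lemma contDiffOn_norm_linProd : ContDiffOn ℝ ∞ (fun q => ‖linProd b q‖) (linNonzero D b) :=
  fun _ hq => (((contDiffOn_linProd hb).contDiffAt
    ((isOpen_prod_univ hD).mem_nhds (linNonzero_subset hq))).norm ℝ hq.2).contDiffWithinAt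

include hD ha hpos in
lemma contDiffOn_hermProd : ContDiffOn ℝ ∞ (hermProd a) (linNonzero D b) :=
  Complex.ofRealCLM.contDiff.comp_contDiffOn ((contDiffOn_hermitianMetric hD ha hpos).mono
    fun _ hq => ⟨hq.1, snd_ne_zero_of_mem hq⟩)

include hD hb in
lemma contDiffOn_absProd : ContDiffOn ℝ ∞ (absProd b) (linNonzero D b) :=
  Complex.ofRealCLM.contDiff.comp_contDiffOn (contDiffOn_norm_linProd hD hb)

include hD ha hpos hb in
lemma linNonzero_subset_regSet : linNonzero D b ⊆ regSet D (randersMetric a b) := by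
  intro p hp
  refine ⟨hp.1, snd_ne_zero_of_mem hp, ?_⟩
  have ho := isOpen_linNonzero hD hb
  filter_upwards [ho.mem_nhds hp] with q hq
  exact ((((contDiffOn_hermitianMetric hD ha hpos).mono
    fun _ hq => ⟨hq.1, snd_ne_zero_of_mem hq⟩).add (contDiffOn_norm_linProd hD hb)).pow 2).contDiffAt
      (ho.mem_nhds hq)

lemma lagrProd_randersMetric :
    lagrProd (randersMetric a b) p =
      (hermProd a p + absProd b p) * (hermProd a p + absProd b p) := by
  simp only [lagrProd, lagr, randersMetric_eq, hermProd, absProd]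
  push_cast; ring

include hpos in
lemma hermProd_mul_self (hp : p.1 ∈ D) : hermProd a p * hermProd a p = sesqProd a p := by
  rw [hermProd, ← Complex.ofReal_mul, ← sq, hermitianMetric_sq hpos hp, sesqProd_re hpos hp]

lemma absProd_mul_self : absProd b p * absProd b p = linProd b p * conj (linProd b p) := by
  rw [Complex.mul_conj', absProd]; ring

include hD ha in
lemma differentiableAt_sesqProd (hp : p.1 ∈ D) : DifferentiableAt ℝ (sesqProd a) p :=
  differentiableAt_of_contDiffOn (isOpen_prod_univ hD) (contDiffOn_sesqProd ha) ⟨hp, trivial⟩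

include hD ha in
lemma dbar_sesqProd (hp : p.1 ∈ D) (v : Cn n) :
    dbar ((0, v) : Cn n × Cn n) (sesqProd a) p = sesq (a p.1) p.2 v := by
  have hd := differentiableAt_sesqProd hD ha hp
  have e : dbar v (fun η => sesqProd a (p.1, η)) p.2 = sesq (a p.1) p.2 v :=
    dbar_sesq_self (M := a p.1) (η := p.2) (v := v)
  rw [← e, dbar_slice_right hd]

include hD ha in
lemma del_sesqProd (hp : p.1 ∈ D) (v : Cn n) :
    del ((0, v) : Cn n × Cn n) (sesqProd a) p = sesq (a p.1) v p.2 := by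
  have hd := differentiableAt_sesqProd hD ha hp
  have e : del v (fun η => sesqProd a (p.1, η)) p.2 = sesq (a p.1) v p.2 :=
    del_sesq_self (M := a p.1) (η := p.2) (v := v)
  rw [← e, del_slice_right hd]

include hD hb in
lemma differentiableAt_linProd (hp : p.1 ∈ D) : DifferentiableAt ℝ (linProd b) p :=
  differentiableAt_of_contDiffOn (isOpen_prod_univ hD) (contDiffOn_linProd hb) ⟨hp, trivial⟩

include hD hb in
lemma dbar_linProd (hp : p.1 ∈ D) (v : Cn n) : dbar ((0, v) : Cn n × Cn n) (linProd b) p = 0 := by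
  have hd := differentiableAt_linProd hD hb hp
  have e : dbar v (fun η => linProd b (p.1, η)) p.2 = 0 :=
    dbar_linForm (c := b p.1) (η := p.2) (v := v)
  rw [← e, dbar_slice_right hd]

include hD hb in
lemma del_linProd (hp : p.1 ∈ D) (v : Cn n) :
    del ((0, v) : Cn n × Cn n) (linProd b) p = linForm (b p.1) v := by
  have hd := differentiableAt_linProd hD hb hp
  have e : del v (fun η => linProd b (p.1, η)) p.2 = linForm (b p.1) v :=
    del_linForm (c := b p.1) (η := p.2) (v := v)
  rw [← e, del_slice_right hd]

end Randers

/-! ### Nondegeneracy of the Randers metric where `β ≠ 0`. -/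

section Levi

variable {n : ℕ} {D : Set (Cn n)} {a : Cn n → Matrix (Fin n) (Fin n) ℂ} {b : Cn n → Cn n}
  {p : Cn n × Cn n}

lemma dbar_hermProd (u : Cn n × Cn n) : dbar u (hermProd a) p = conj (del u (hermProd a) p) :=
  dbar_ofReal _

lemma dbar_absProd (u : Cn n × Cn n) : dbar u (absProd b) p = conj (del u (absProd b) p) :=
  dbar_ofReal _

variable (hD : IsOpen D) (ha : ∀ i j, ContDiffOn ℝ ∞ (fun z => a z i j) D)
  (hpos : ∀ z ∈ D, (a z).PosDef) (hb : ContDiffOn ℝ ∞ b D)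

include hD ha hpos hb in
lemma differentiableAt_hermProd (hp : p ∈ linNonzero D b) : DifferentiableAt ℝ (hermProd a) p :=
  differentiableAt_of_contDiffOn (isOpen_linNonzero hD hb) (contDiffOn_hermProd hD ha hpos) hp

include hD hb in
lemma differentiableAt_absProd (hp : p ∈ linNonzero D b) : DifferentiableAt ℝ (absProd b) p :=
  differentiableAt_of_contDiffOn (isOpen_linNonzero hD hb) (contDiffOn_absProd hD hb) hp

include hD ha hpos hb in
lemma del_hermProd (hp : p ∈ linNonzero D b) (u : Cn n × Cn n) :
    2 * (hermProd a p * del u (hermProd a) p) = del u (sesqProd a) p := by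
  have hd := differentiableAt_hermProd hD ha hpos hb hp
  rw [← del_congr_of_eqOn (isOpen_linNonzero hD hb)
    (fun q (hq : q ∈ linNonzero D b) => hermProd_mul_self hpos hq.1) hp, del_mul hd hd]
  ring

include hD ha hpos hb in
lemma two_mul_dbar_hermProd (hp : p ∈ linNonzero D b) (u : Cn n × Cn n) :
    2 * (hermProd a p * dbar u (hermProd a) p) = dbar u (sesqProd a) p := by
  have hd := differentiableAt_hermProd hD ha hpos hb hp
  rw [← dbar_congr_of_eqOn (isOpen_linNonzero hD hb)
    (fun q (hq : q ∈ linNonzero D b) => hermProd_mul_self hpos hq.1) hp, dbar_mul hd hd]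
  ring

lemma differentiableAt_conj {E : Type*} [NormedAddCommGroup E] [NormedSpace ℝ E] {f : E → ℂ} {x : E}
    (hf : DifferentiableAt ℝ f x) : DifferentiableAt ℝ (fun y => conj (f y)) x :=
  Complex.conjCLE.differentiableAt.comp x hf

include hD hb in
lemma two_mul_del_absProd (hp : p ∈ linNonzero D b) (u : Cn n × Cn n) :
    2 * (absProd b p * del u (absProd b) p) =
      linProd b p * conj (dbar u (linProd b) p) + conj (linProd b p) * del u (linProd b) p := by
  have hd := differentiableAt_absProd hD hb hp
  have hl := differentiableAt_linProd hD hb hp.1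
  have e : del u (fun q => absProd b q * absProd b q) p =
      del u (fun q => linProd b q * conj (linProd b q)) p := by
    simp only [absProd_mul_self]
  rw [del_mul hd hd, del_mul hl (differentiableAt_conj hl), del_conj] at e
  linear_combination e

include hD hb in
lemma two_mul_dbar_absProd (hp : p ∈ linNonzero D b) (u : Cn n × Cn n) :
    2 * (absProd b p * dbar u (absProd b) p) =
      linProd b p * conj (del u (linProd b) p) + conj (linProd b p) * dbar u (linProd b) p := by
  have hd := differentiableAt_absProd hD hb hp
  have hl := differentiableAt_linProd hD hb hp.1
  have e : dbar u (fun q => absProd b q * absProd b q) p =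
      dbar u (fun q => linProd b q * conj (linProd b q)) p := by
    simp only [absProd_mul_self]
  rw [dbar_mul hd hd, dbar_mul hl (differentiableAt_conj hl), dbar_conj] at e
  linear_combination e

include hD ha hpos hb in
-- Differentiating `α · α = a(η, η)` twice gives `α ∂∂̄α + |∂α|² = a(v, v)/2`, while `2α ∂α = a(v,
-- η)` and Cauchy–Schwarz give `|∂α|² ≤ a(v, v)/4`.
lemma levi_hermProd_pos (hp : p ∈ linNonzero D b) {v : Cn n} (hv : v ≠ 0) :
    0 < (del ((0, v) : Cn n × Cn n) (dbar ((0, v) : Cn n × Cn n) (hermProd a)) p).re := by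
  set u : Cn n × Cn n := (0, v) with hu
  have ho := isOpen_linNonzero hD hb
  have hd := differentiableAt_hermProd hD ha hpos hb hp
  have hd2 : DifferentiableAt ℝ (dbar u (hermProd a)) p :=
    differentiableAt_of_contDiffOn ho (contDiffOn_dbar ho (contDiffOn_hermProd hD ha hpos)) hp
  have e1 : Set.EqOn (fun q => hermProd a q * dbar u (hermProd a) q)
      (fun q => (1 / 2 : ℂ) * dbar u (sesqProd a) q) (linNonzero D b) := fun q hq => by
    have := two_mul_dbar_hermProd hD ha hpos hb hq u
    linear_combination (1 / 2 : ℂ) * this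
  have hds : DifferentiableAt ℝ (dbar u (sesqProd a)) p :=
    differentiableAt_of_contDiffOn (isOpen_prod_univ hD)
      (contDiffOn_dbar (isOpen_prod_univ hD) (contDiffOn_sesqProd ha)) (linNonzero_subset hp)
  have e2 := del_congr_of_eqOn (u := u) ho e1 hp
  rw [del_mul hd hd2, del_const_mul _ hds] at e2
  have e3 : del u (dbar u (sesqProd a)) p = sesq (a p.1) v v := by
    have h1 : del v (fun η => dbar u (sesqProd a) (p.1, η)) p.2 = sesq (a p.1) v v := by
      have : (fun η => dbar u (sesqProd a) (p.1, η)) = fun η => sesq (a p.1) η v := by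
        ext η
        exact dbar_sesqProd (p := (p.1, η)) hD ha hp.1 v
      rw [this, del_sesq_left]
    rw [← h1, del_slice_right hds]
  have e4 := del_hermProd hD ha hpos hb hp u
  rw [hu, del_sesqProd hD ha hp.1, ← hu] at e4
  rw [e3, dbar_hermProd] at e2
  set x := del u (hermProd a) p
  set y := del u (dbar u (hermProd a)) p
  set σ := hermitianMetric a p.1 p.2
  have hσ : 0 < σ := hermitianMetric_pos hpos hp.1 (snd_ne_zero_of_mem hp)
  have hσ2 : σ ^ 2 = (sesq (a p.1) p.2 p.2).re := hermitianMetric_sq hpos hp.1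
  have e4' : 4 * (σ ^ 2 * ‖x‖ ^ 2) = ‖sesq (a p.1) v p.2‖ ^ 2 := by
    rw [← e4]
    have : hermProd a p = (σ : ℂ) := rfl
    rw [this, norm_mul, norm_mul, Complex.norm_real, Real.norm_of_nonneg hσ.le]
    norm_num; ring
  have cs := norm_sesq_sq_le (v := v) (η := p.2) (hpos _ hp.1)
  rw [← e4', ← hσ2] at cs
  have hvv := sesq_self_pos (hpos _ hp.1) hv
  have hx : 4 * ‖x‖ ^ 2 ≤ (sesq (a p.1) v v).re := by
    have : 0 < σ ^ 2 := by positivity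
    nlinarith
  have e5 : σ * y.re + ‖x‖ ^ 2 = (1 / 2) * (sesq (a p.1) v v).re := by
    have := congrArg Complex.re e2
    have h1 : hermProd a p = (σ : ℂ) := rfl
    rw [h1, mul_comm (conj x) x, Complex.mul_conj', ← Complex.ofReal_pow, Complex.add_re,
      Complex.re_ofReal_mul, Complex.ofReal_re,
      show (1 / 2 : ℂ) = ((1 / 2 : ℝ) : ℂ) by norm_num, Complex.re_ofReal_mul] at this
    exact this
  have : 0 < σ * y.re := by linarith
  exact pos_of_mul_pos_right this hσ.le

include hD hb in
-- The same computation for `|β|² = β β̄` with `β` holomorphic in `η`: now `|∂|β||² = |b(v)|²/4`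
-- exactly, so `|β| ∂∂̄|β| = |b(v)|²/4`.
lemma levi_absProd_nonneg (hp : p ∈ linNonzero D b) (v : Cn n) :
    0 ≤ (del ((0, v) : Cn n × Cn n) (dbar ((0, v) : Cn n × Cn n) (absProd b)) p).re := by
  set u : Cn n × Cn n := (0, v) with hu
  have ho := isOpen_linNonzero hD hb
  have hd := differentiableAt_absProd hD hb hp
  have hl := differentiableAt_linProd hD hb hp.1
  have hd2 : DifferentiableAt ℝ (dbar u (absProd b)) p :=
    differentiableAt_of_contDiffOn ho (contDiffOn_dbar ho (contDiffOn_absProd hD hb)) hp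
  have e4 := two_mul_del_absProd hD hb hp u
  rw [hu, del_linProd hD hb hp.1, dbar_linProd hD hb hp.1, ← hu, map_zero, mul_zero, zero_add] at e4
  have hconst : del v (fun η => dbar u (absProd b) (p.1, η)) p.2 = del u (dbar u (absProd b)) p :=
    del_slice_right hd2 v
  have e1 : Set.EqOn (fun q => absProd b q * dbar u (absProd b) q)
      (fun q => (1 / 2 : ℂ) * (linProd b q * conj (del u (linProd b) q)))
      (linNonzero D b) := fun q hq => by
    have := two_mul_dbar_absProd hD hb hq u
    have h0 : dbar u (linProd b) q = 0 := dbar_linProd hD hb hq.1 v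
    rw [h0] at this
    linear_combination (1 / 2 : ℂ) * this
  have hcd : DifferentiableAt ℝ (fun q => conj (del u (linProd b) q)) p :=
    differentiableAt_conj (differentiableAt_of_contDiffOn (isOpen_prod_univ hD)
      (contDiffOn_del (isOpen_prod_univ hD) (contDiffOn_linProd hb)) (linNonzero_subset hp))
  have e2 := del_congr_of_eqOn (u := u) ho e1 hp
  have h0 : dbar u (del u (linProd b)) p = 0 := by
    rw [← del_dbar_comm (isOpen_prod_univ hD) (contDiffOn_linProd hb) (linNonzero_subset hp),
      del_congr_of_eqOn (g := fun _ => 0) (isOpen_prod_univ hD)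
        (fun q hq => dbar_linProd hD hb hq.1 v) (linNonzero_subset hp), del_const]
  rw [del_mul hd hd2, del_const_mul _ (hl.fun_mul hcd), del_mul hl hcd, del_conj, h0] at e2
  have e3 : del u (linProd b) p = linForm (b p.1) v := del_linProd hD hb hp.1 v
  rw [e3, dbar_absProd] at e2
  set x := del u (absProd b) p
  set y := del u (dbar u (absProd b)) p
  set τ := ‖linProd b p‖
  have hτ : 0 < τ := norm_pos_iff.mpr hp.2
  have hab : absProd b p = (τ : ℂ) := rfl
  have e4' : 4 * ‖x‖ ^ 2 = ‖linForm (b p.1) v‖ ^ 2 := by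
    have h1 := congrArg norm e4
    rw [hab, norm_mul, norm_mul, norm_mul, Complex.norm_real, Real.norm_of_nonneg hτ.le,
      RCLike.norm_conj] at h1
    have h2 : 2 * ‖x‖ = ‖linForm (b p.1) v‖ := by
      have : τ * (2 * ‖x‖) = τ * ‖linForm (b p.1) v‖ := by
        rw [← h1]; norm_num; ring
      exact mul_left_cancel₀ hτ.ne' this
    rw [← h2]; ring
  have e5 : τ * y.re + ‖x‖ ^ 2 = (1 / 2) * ‖linForm (b p.1) v‖ ^ 2 := by
    have := congrArg Complex.re e2
    rw [map_zero, mul_zero, zero_add, hab, mul_comm (conj x) x, Complex.mul_conj',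
      mul_comm (conj _) (linForm _ _), Complex.mul_conj',
      ← Complex.ofReal_pow, ← Complex.ofReal_pow, Complex.add_re,
      Complex.re_ofReal_mul, Complex.ofReal_re,
      show (1 / 2 : ℂ) = ((1 / 2 : ℝ) : ℂ) by norm_num, Complex.re_ofReal_mul,
      Complex.ofReal_re] at this
    exact this
  have : 0 ≤ τ * y.re := by nlinarith [sq_nonneg ‖x‖]
  exact nonneg_of_mul_nonneg_right this hτ

include hD ha hpos hb in
/-- The Levi form of a Randers Lagrangian is positive definite away from the zeros of `β`. -/
lemma levi_randersMetric_pos (hp : p ∈ linNonzero D b) {v : Cn n} (hv : v ≠ 0) :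
    0 < (del ((0, v) : Cn n × Cn n) (dbar ((0, v) : Cn n × Cn n)
      (lagrProd (randersMetric a b))) p).re := by
  have h1 := levi_hermProd_pos hD ha hpos hb hp hv
  have h2 := levi_absProd_nonneg hD hb hp v
  set u : Cn n × Cn n := (0, v) with hu
  have ho := isOpen_linNonzero hD hb
  let s : Cn n × Cn n → ℂ := fun q => hermProd a q + absProd b q
  have hs : ContDiffOn ℝ ∞ s (linNonzero D b) :=
    (contDiffOn_hermProd hD ha hpos).add (contDiffOn_absProd hD hb)
  have hds := fun q (hq : q ∈ linNonzero D b) => differentiableAt_of_contDiffOn ho hs hq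
  have hds2 : DifferentiableAt ℝ (dbar u s) p :=
    differentiableAt_of_contDiffOn ho (contDiffOn_dbar ho hs) hp
  have e1 : Set.EqOn (dbar u (lagrProd (randersMetric a b))) (fun q => 2 * (s q * dbar u s q))
      (linNonzero D b) := fun q hq => by
    have : lagrProd (randersMetric a b) = fun q => s q * s q := funext fun q => lagrProd_randersMetric
    rw [this, dbar_mul (hds q hq) (hds q hq)]; ring
  rw [del_congr_of_eqOn ho e1 hp, del_const_mul _ ((hds p hp).fun_mul hds2), del_mul (hds p hp) hds2]
  have e2 : Set.EqOn (dbar u s) (fun q => dbar u (hermProd a) q + dbar u (absProd b) q)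
      (linNonzero D b) := fun q hq =>
    dbar_add (differentiableAt_hermProd hD ha hpos hb hq) (differentiableAt_absProd hD hb hq)
  have e3 : del u (dbar u s) p = del u (dbar u (hermProd a)) p + del u (dbar u (absProd b)) p := by
    rw [del_congr_of_eqOn ho e2 hp, del_add]
    · exact differentiableAt_of_contDiffOn ho
        (contDiffOn_dbar ho (contDiffOn_hermProd hD ha hpos)) hp
    · exact differentiableAt_of_contDiffOn ho (contDiffOn_dbar ho (contDiffOn_absProd hD hb)) hp
  have e4 : dbar u s p = conj (del u s p) := by
    have : s = fun q => ((hermitianMetric a q.1 q.2 + ‖linProd b q‖ : ℝ) : ℂ) := by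
      ext q; simp [s, hermProd, absProd]
    rw [this]; exact dbar_ofReal _
  have e5 : s p = ((hermitianMetric a p.1 p.2 + ‖linProd b p‖ : ℝ) : ℂ) := by
    simp [s, hermProd, absProd]
  -- For real `s = α + |β|` the Levi form of `s²` is `2(s ∂∂̄s + |∂s|²)`.
  rw [e3, e4, e5, mul_comm (conj _), Complex.mul_conj', ← Complex.ofReal_pow,
    show (2 : ℂ) = ((2 : ℝ) : ℂ) by norm_num, Complex.re_ofReal_mul, Complex.add_re,
    Complex.re_ofReal_mul, Complex.ofReal_re, Complex.add_re]
  have h3 : 0 < hermitianMetric a p.1 p.2 := hermitianMetric_pos hpos hp.1 (snd_ne_zero_of_mem hp)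
  positivity

lemma sum_fund_eq_levi {F : Cn n → Cn n → ℝ} {U : Set (Cn n × Cn n)} (hU : IsOpen U)
    (hL : ContDiffOn ℝ ∞ (lagrProd F) U) (hp : p ∈ U) (v : Cn n) :
    ∑ j, conj (v j) * ∑ i, v i * fund F p.1 p.2 i j =
      del ((0, v) : Cn n × Cn n) (dbar ((0, v) : Cn n × Cn n) (lagrProd F)) p := by
  have h1 : dbar ((0, v) : Cn n × Cn n) (lagrProd F) =
      fun q => ∑ j, conj (v j) * dbar (ev j) (lagrProd F) q := by
    ext q
    rw [← sum_smul_ev, dbar_sum_dir]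
    simp only [dbar_smul_dir]
  have hd : ∀ j, DifferentiableAt ℝ (dbar (ev j) (lagrProd F)) p := fun j =>
    differentiableAt_of_contDiffOn hU (contDiffOn_dbar hU hL) hp
  rw [h1, del_sum fun j _ => (hd j).const_mul _]
  refine Finset.sum_congr rfl fun j _ => ?_
  rw [del_const_mul _ (hd j), ← sum_smul_ev, del_sum_dir]
  simp only [del_smul_dir, fund_eq hU hL hp]

include hD ha hpos hb in
-- A vector in the left kernel of `g` would make the positive Levi form vanish.
lemma det_fund_randersMetric (hp : p ∈ linNonzero D b) :
    (fund (randersMetric a b) p.1 p.2).det ≠ 0 := by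
  intro hdet
  obtain ⟨v, hv, h⟩ := Matrix.exists_vecMul_eq_zero_iff.mpr hdet
  have h1 := levi_randersMetric_pos hD ha hpos hb hp hv
  rw [← sum_fund_eq_levi (isOpen_linNonzero hD hb)
    (contDiffOn_lagrProd.mono (linNonzero_subset_regSet hD ha hpos hb)) hp] at h1
  have h2 : ∀ j, ∑ i, v i * fund (randersMetric a b) p.1 p.2 i j = 0 := fun j => by
    simpa [Matrix.vecMul, dotProduct] using congrFun h j
  simp [h2] at h1

end Levi

/-! ### Vanishing by one-sided limits. -/

section Limits

lemma eq_zero_of_eventually_punctured {f : ℝ → ℂ} (hf : ContinuousAt f 0)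
    (h : ∀ᶠ t in 𝓝[≠] (0 : ℝ), f t = 0) : f 0 = 0 :=
  tendsto_nhds_unique (hf.tendsto.mono_left nhdsWithin_le_nhds)
    (tendsto_const_nhds.congr' (h.mono fun _ ht => ht.symm))

lemma eq_zero_of_sign_change {f g : ℝ → ℂ} (hf : ContinuousAt f 0) (hg : ContinuousAt g 0)
    (h1 : ∀ t > 0, f t = -g t) (h2 : ∀ t < 0, f t = g t) : f 0 = 0 ∧ g 0 = 0 := by
  have a1 : f 0 = -g 0 := by
    refine tendsto_nhds_unique (l := 𝓝[>] (0 : ℝ)) (hf.tendsto.mono_left nhdsWithin_le_nhds)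
      ((hg.neg.tendsto.mono_left nhdsWithin_le_nhds).congr' ?_)
    filter_upwards [self_mem_nhdsWithin] with t ht using (h1 t ht).symm
  have a2 : f 0 = g 0 := by
    refine tendsto_nhds_unique (l := 𝓝[<] (0 : ℝ)) (hf.tendsto.mono_left nhdsWithin_le_nhds)
      ((hg.tendsto.mono_left nhdsWithin_le_nhds).congr' ?_)
    filter_upwards [self_mem_nhdsWithin] with t ht using (h2 t ht).symm
  have a3 : g 0 = 0 := self_eq_neg.mp (a2.symm.trans a1)
  exact ⟨a2.trans a3, a3⟩

/-- If a quadratic polynomial equals `∓σ` times an affine function for `±t > 0`, with `σ` continuous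
and non-zero at `0`, then both polynomials vanish. -/
lemma quadratic_eq_zero_of_sign_change {σ : ℝ → ℂ} (hσ : ContinuousAt σ 0) (hσ0 : σ 0 ≠ 0)
    {r₀ r₁ r₂ m₀ m₁ : ℂ} (h1 : ∀ t : ℝ, 0 < t → r₀ + t * r₁ + t ^ 2 * r₂ = -(σ t * (m₀ + t * m₁)))
    (h2 : ∀ t : ℝ, t < 0 → r₀ + t * r₁ + t ^ 2 * r₂ = σ t * (m₀ + t * m₁)) :
    r₀ + r₁ + r₂ = 0 := by
  obtain ⟨e1, e2⟩ := eq_zero_of_sign_change (f := fun t : ℝ => r₀ + t * r₁ + t ^ 2 * r₂)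
    (g := fun t : ℝ => σ t * (m₀ + t * m₁)) (by fun_prop) (by fun_prop) h1 h2
  have hr0 : r₀ = 0 := by simpa using e1
  have hm0 : m₀ = 0 := by simpa [hσ0] using e2
  subst hr0 hm0
  -- The constant terms are gone, so both relations can be divided by `t` and the limit argument
  -- repeated. Once `m₁ = 0` as well, the relation at `t = 1` is the claim.
  obtain ⟨e3, e4⟩ := eq_zero_of_sign_change (f := fun t : ℝ => r₁ + t * r₂)
    (g := fun t : ℝ => σ t * m₁) (by fun_prop) (by fun_prop)
    (fun t ht => by
      have ht' : (t : ℂ) ≠ 0 := by exact_mod_cast ht.ne'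
      apply mul_left_cancel₀ ht'
      linear_combination h1 t ht)
    (fun t ht => by
      have ht' : (t : ℂ) ≠ 0 := by exact_mod_cast ht.ne
      apply mul_left_cancel₀ ht'
      linear_combination h2 t ht)
  have hm1 : m₁ = 0 := by simpa [hσ0] using e4
  have := h1 1 one_pos
  rw [hm1] at this
  simpa using this

end Limits

/-! ### From stationarity of `α + |β|` to stationarity of `α`. -/

section Stationary

variable {n : ℕ} {D : Set (Cn n)} {a : Cn n → Matrix (Fin n) (Fin n) ℂ} {b : Cn n → Cn n}
  {p : Cn n × Cn n}

lemma continuous_sesq_self {M : Matrix (Fin n) (Fin n) ℂ} : Continuous fun η : Cn n => sesq M η η := by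
  unfold sesq
  refine continuous_finsetSum _ fun i _ => continuous_finsetSum _ fun j _ => ?_
  exact (continuous_const.mul (continuous_apply i)).mul
    (Complex.continuous_conj.comp (continuous_apply j))

lemma continuous_linForm {c : Cn n} : Continuous fun η : Cn n => linForm c η := by
  unfold linForm; fun_prop

variable (hD : IsOpen D) (ha : ∀ i j, ContDiffOn ℝ ∞ (fun z => a z i j) D)
  (hpos : ∀ z ∈ D, (a z).PosDef) (hb : ContDiffOn ℝ ∞ b D)

include hD ha in
lemma fderiv_sesqProd (hp : p.1 ∈ D) (h : Cn n) : fderiv ℝ (sesqProd a) p (h, 0) =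
    sesq (Matrix.of fun i j => fderiv ℝ (fun z => a z i j) p.1 h) p.2 p.2 := by
  have hd := differentiableAt_sesqProd hD ha hp
  have hda : ∀ i j, DifferentiableAt ℝ (fun z => a z i j) p.1 := fun i j =>
    differentiableAt_of_contDiffOn hD (ha i j) hp
  rw [← fderiv_slice_left hd]
  have e : (fun z => sesqProd a (z, p.2)) =
      fun z => ∑ i, ∑ j, a z i j * p.2 i * conj (p.2 j) := rfl
  rw [e, fderiv_fun_sum fun i _ => DifferentiableAt.fun_sum fun j _ =>
    ((hda i j).mul_const _).mul_const _]
  simp only [sum_apply, sesq, Matrix.of_apply]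
  refine Finset.sum_congr rfl fun i _ => ?_
  rw [fderiv_fun_sum fun j _ => ((hda i j).mul_const _).mul_const _]
  simp only [sum_apply]
  refine Finset.sum_congr rfl fun j _ => ?_
  rw [fderiv_mul_const ((hda i j).mul_const _), fderiv_mul_const (hda i j)]
  simp only [smul_apply, smul_eq_mul]
  ring

include hD hb in
lemma fderiv_linProd (hp : p.1 ∈ D) (h : Cn n) : fderiv ℝ (linProd b) p (h, 0) =
    linForm (fun i => fderiv ℝ (fun z => b z i) p.1 h) p.2 := by
  have hd := differentiableAt_linProd hD hb hp
  have hdb : ∀ i, DifferentiableAt ℝ (fun z => b z i) p.1 := fun i =>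
    differentiableAt_of_contDiffOn hD ((contDiff_apply ℝ ℂ i).comp_contDiffOn hb) hp
  rw [← fderiv_slice_left hd]
  have e : (fun z => linProd b (z, p.2)) = fun z => ∑ i, b z i * p.2 i := rfl
  rw [e, fderiv_fun_sum fun i _ => (hdb i).mul_const _]
  simp only [sum_apply, linForm]
  refine Finset.sum_congr rfl fun i _ => ?_
  rw [fderiv_mul_const (hdb i)]
  simp only [smul_apply, smul_eq_mul]
  ring

include hD ha hpos hb in
-- Since `α + |β| > 0`, the hypothesis says `dα = -d|β|`; multiplying by `2α|β|` leaves only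
-- derivatives of `α²` and `β`, which in base directions are polynomial in `η` and `η̄`.
lemma absProd_mul_fderiv_sesqProd (hp : p ∈ linNonzero D b) {u : Cn n × Cn n}
    (h : fderiv ℝ (lagrProd (randersMetric a b)) p u = 0) :
    absProd b p * fderiv ℝ (sesqProd a) p u =
      -(hermProd a p * (linProd b p * conj (fderiv ℝ (linProd b) p u) +
        conj (linProd b p) * fderiv ℝ (linProd b) p u)) := by
  have hd1 := differentiableAt_hermProd hD ha hpos hb hp
  have hd2 := differentiableAt_absProd hD hb hp
  have e1 : fderiv ℝ (sesqProd a) p u = 2 * (hermProd a p * fderiv ℝ (hermProd a) p u) := by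
    rw [fderiv_eq_del_add_dbar, fderiv_eq_del_add_dbar (f := hermProd a),
      ← del_hermProd hD ha hpos hb hp, ← two_mul_dbar_hermProd hD ha hpos hb hp]
    ring
  have e2 : 2 * (absProd b p * fderiv ℝ (absProd b) p u) =
      linProd b p * conj (fderiv ℝ (linProd b) p u) +
        conj (linProd b p) * fderiv ℝ (linProd b) p u := by
    rw [fderiv_eq_del_add_dbar, fderiv_eq_del_add_dbar (f := linProd b), map_add, mul_add, mul_add,
      two_mul_del_absProd hD hb hp, two_mul_dbar_absProd hD hb hp]
    ring
  have e3 : lagrProd (randersMetric a b) = fun q =>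
      (hermProd a q + absProd b q) * (hermProd a q + absProd b q) :=
    funext fun q => lagrProd_randersMetric
  rw [e3, fderiv_fun_mul (hd1.fun_add hd2) (hd1.fun_add hd2), fderiv_fun_add hd1 hd2] at h
  simp only [add_apply, smul_apply, smul_eq_mul] at h
  have hs : hermProd a p + absProd b p ≠ 0 := by
    have h3 : 0 < hermitianMetric a p.1 p.2 := hermitianMetric_pos hpos hp.1 (snd_ne_zero_of_mem hp)
    have : hermProd a p + absProd b p = ((hermitianMetric a p.1 p.2 + ‖linProd b p‖ : ℝ) : ℂ) := by
      simp [hermProd, absProd]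
    rw [this]
    have : 0 < hermitianMetric a p.1 p.2 + ‖linProd b p‖ := by positivity
    exact_mod_cast this.ne'
  have e4 : fderiv ℝ (hermProd a) p u + fderiv ℝ (absProd b) p u = 0 := by
    have : (2 * (hermProd a p + absProd b p)) *
        (fderiv ℝ (hermProd a) p u + fderiv ℝ (absProd b) p u) = 0 := by
      linear_combination h
    exact (mul_eq_zero.mp this).resolve_left (mul_ne_zero two_ne_zero hs)
  rw [e1, ← e2]
  linear_combination 2 * absProd b p * hermProd a p * e4

include hD ha hpos hb in
-- Restricted to a line `u + tv` with `β(u) = 0`, the identity has `|t|` on one side and `t` on the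
-- other. After cancelling `t`, the two sides differ by a sign that jumps at `t = 0`, where `α(u) ≠
-- 0`.
lemma fderiv_sesqProd_eq_zero (hn : 2 ≤ n) {z : Cn n} (hz : z ∈ D) (hbz : b z ≠ 0) (h : Cn n)
    (hL : ∀ η, linForm (b z) η ≠ 0 →
      fderiv ℝ (lagrProd (randersMetric a b)) (z, η) (h, 0) = 0) (η : Cn n) :
    fderiv ℝ (sesqProd a) (z, η) (h, 0) = 0 := by
  rw [fderiv_sesqProd (p := (z, η)) hD ha hz h]
  simp only
  set A : Matrix (Fin n) (Fin n) ℂ := Matrix.of fun i j => fderiv ℝ (fun z => a z i j) z h with hA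
  set B : Cn n := fun i => fderiv ℝ (fun z => b z i) z h with hB
  have hid : ∀ η, linForm (b z) η ≠ 0 → (‖linForm (b z) η‖ : ℂ) * sesq A η η =
      -((hermitianMetric a z η : ℂ) * (linForm (b z) η * conj (linForm B η) +
        conj (linForm (b z) η) * linForm B η)) := by
    intro η hη
    have e := absProd_mul_fderiv_sesqProd (p := (z, η)) (u := (h, 0)) hD ha hpos hb ⟨hz, hη⟩ (hL η hη)
    rw [fderiv_sesqProd (p := (z, η)) hD ha hz h, fderiv_linProd (p := (z, η)) hD hb hz h] at e
    exact e
  have hne : ∀ η, linForm (b z) η ≠ 0 → sesq A η η = 0 := by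
    intro η hη
    obtain ⟨u, hu0, hu⟩ := exists_linForm_eq_zero hn (b z)
    -- The line is chosen to pass through `u` at `t = 0` and through `η` at `t = 1`.
    obtain ⟨v, hv⟩ : ∃ v, v = η - u := ⟨_, rfl⟩
    have hηuv : η = u + v := by rw [hv]; abel
    have hk : linForm (b z) v ≠ 0 := by
      rw [hηuv, linForm_add, hu, zero_add] at hη
      exact hη
    set k := linForm (b z) v
    have hlin : ∀ t : ℝ, linForm (b z) (u + (t : ℂ) • v) = t * k := fun t => by
      rw [linForm_add, linForm_smul, hu, zero_add]
    have hk' : (‖k‖ : ℂ) ≠ 0 := by exact_mod_cast (norm_pos_iff.mpr hk).ne'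
    have main : ∀ t : ℝ, t ≠ 0 → ((|t| : ℝ) : ℂ) * ‖k‖ *
        (sesq A u u + t * (sesq A u v + sesq A v u) + t ^ 2 * sesq A v v) =
        -((hermitianMetric a z (u + (t : ℂ) • v) : ℂ) * (t *
          ((k * conj (linForm B u) + conj k * linForm B u) +
            t * (k * conj (linForm B v) + conj k * linForm B v)))) := by
      intro t ht
      have hne : linForm (b z) (u + (t : ℂ) • v) ≠ 0 := by
        rw [hlin]; exact mul_ne_zero (by exact_mod_cast ht) hk
      have e := hid _ hne
      rw [hlin, norm_mul, Complex.norm_real, Real.norm_eq_abs] at e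
      simp only [sesq_add_left, sesq_add_right, sesq_smul_left, sesq_smul_right, linForm_add,
        linForm_smul, map_add, map_mul, Complex.conj_ofReal] at e
      push_cast at e
      linear_combination e
    have hσ : ContinuousAt (fun t : ℝ => (hermitianMetric a z (u + (t : ℂ) • v) : ℂ) / ‖k‖) 0 := by
      have h1 : Continuous fun η : Cn n => hermitianMetric a z η :=
        Real.continuous_sqrt.comp (Complex.continuous_re.comp continuous_sesq_self)
      have h2 : Continuous fun t : ℝ => u + (t : ℂ) • v := by fun_prop
      exact ((Complex.continuous_ofReal.comp (h1.comp h2)).div_const _).continuousAt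
    have := quadratic_eq_zero_of_sign_change hσ (r₀ := sesq A u u)
      (r₁ := sesq A u v + sesq A v u) (r₂ := sesq A v v)
      (m₀ := k * conj (linForm B u) + conj k * linForm B u)
      (m₁ := k * conj (linForm B v) + conj k * linForm B v) ?_ ?_ ?_
    · rw [hηuv]
      simp only [sesq_add_left, sesq_add_right]
      linear_combination this
    · have := hermitianMetric_pos (p := (z, u)) hpos hz hu0
      simpa using ⟨this.ne', hk⟩
    · intro t ht
      have e := main t ht.ne'
      rw [abs_of_pos ht] at e
      have ht' : (t : ℂ) ≠ 0 := by exact_mod_cast ht.ne'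
      apply mul_left_cancel₀ (mul_ne_zero ht' hk')
      rw [e]; field_simp
    · intro t ht
      have e := main t ht.ne
      rw [abs_of_neg ht] at e
      push_cast at e
      have ht' : (t : ℂ) ≠ 0 := by exact_mod_cast ht.ne
      apply mul_left_cancel₀ (mul_ne_zero (neg_ne_zero.mpr ht') hk')
      rw [e]; field_simp
  -- Zeros of `β(z, ·)` are limits of nonzeros because `b z ≠ 0`.
  by_cases hη : linForm (b z) η = 0
  · obtain ⟨v, hv⟩ := exists_linForm_ne_zero hbz
    have hc : Continuous fun t : ℝ => sesq A (η + (t : ℂ) • v) (η + (t : ℂ) • v) :=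
      continuous_sesq_self.comp (by fun_prop)
    have := eq_zero_of_eventually_punctured hc.continuousAt (by
      filter_upwards [self_mem_nhdsWithin] with t ht
      apply hne
      rw [linForm_add, linForm_smul, hη, zero_add]
      exact mul_ne_zero (by exact_mod_cast ht) hv)
    simpa using this
  · exact hne η hη

lemma fderiv_lagrProd_eq_zero {F : Cn n → Cn n → ℝ}
    (h : ∀ k, del (ez k) (lagrProd F) p = 0) (v : Cn n) : fderiv ℝ (lagrProd F) p (v, 0) = 0 := by
  have h1 : del ((v, 0) : Cn n × Cn n) (lagrProd F) p = 0 := by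
    rw [← sum_smul_ez, del_sum_dir]
    simp only [del_smul_dir, h, mul_zero, Finset.sum_const_zero]
  rw [fderiv_eq_del_add_dbar, dbar_lagrProd, h1]; simp

include hpos in
lemma lagrProd_randersMetric_ne_zero (hp : p.1 ∈ D) (hη : p.2 ≠ 0) :
    lagrProd (randersMetric a b) p ≠ 0 := by
  have h := hermitianMetric_pos hpos hp hη
  have h2 : 0 < randersMetric a b p.1 p.2 ^ 2 := by
    rw [randersMetric_eq]; positivity
  exact Complex.ofReal_ne_zero.mpr h2.ne'

lemma randersMetric_of_eq_zero {z : Cn n} (h : b z = 0) : randersMetric a b z = hermitianMetric a z := by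
  ext η
  simp [randersMetric_eq, linProd, linForm, h]

include hpos in
lemma lagrProd_randersMetric_of_eq_zero (hp : p.1 ∈ D) (h : linProd b p = 0) :
    lagrProd (randersMetric a b) p = sesqProd a p := by
  rw [lagrProd_randersMetric, absProd, h]
  simp [hermProd_mul_self hpos hp]

include hD ha hpos hb in
lemma del_lagrProd_randersMetric_eq_zero
    (h : GeodesicsReparametrize D euclideanMetric (randersMetric a b)) (hp : p ∈ linNonzero D b)
    (k : Fin n) : del (ez k) (lagrProd (randersMetric a b)) p = 0 := by
  refine h.del_lagrProd_eq_zero hD isHomogeneous_randersMetric (isOpen_linNonzero hD hb)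
    (linNonzero_subset_regSet hD ha hpos hb) (fun q hq c hc => ⟨hq.1, ?_⟩)
    (fun q hq => det_fund_randersMetric hD ha hpos hb hq)
    (fun q hq => lagrProd_randersMetric_ne_zero hpos hq.1 (snd_ne_zero_of_mem hq)) hp k
  rw [linProd, linForm_smul]
  exact mul_ne_zero hc hq.2

include hD ha hpos in
/-- Over the interior of the zero set of `b` the Randers metric is `α`. -/
lemma del_sesqProd_eq_zero_of_interior
    (h : GeodesicsReparametrize D euclideanMetric (randersMetric a b))
    (hp : p.1 ∈ interior {z | z ∈ D ∧ b z = 0}) (hη : p.2 ≠ 0) (k : Fin n) :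
    del (ez k) (sesqProd a) p = 0 := by
  set S := interior {z | z ∈ D ∧ b z = 0}
  -- Over `S` no direction need be excluded: the metric agrees with `α`, hence is regular and
  -- nondegenerate on all of this cone.
  set V : Set (Cn n × Cn n) := {q | q.1 ∈ S ∧ q.2 ≠ 0}
  have hVo : IsOpen V := isOpen_prod_ne isOpen_interior
  have hS : ∀ q ∈ V, q.1 ∈ D ∧ b q.1 = 0 := fun q hq =>
    (interior_subset hq.1 : q.1 ∈ {z | z ∈ D ∧ b z = 0})
  have heq : ∀ q ∈ V, lagrProd (randersMetric a b) q = sesqProd a q := fun q hq =>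
    lagrProd_randersMetric_of_eq_zero hpos (hS q hq).1 (by simp [linProd, linForm, (hS q hq).2])
  have hV : V ⊆ regSet D (randersMetric a b) := by
    intro q hq
    refine ⟨(hS q hq).1, hq.2, ?_⟩
    have h1 := (mem_regSet_hermitianMetric hD ha hpos (hS q hq).1 hq.2).2.2
    filter_upwards [hVo.mem_nhds hq, h1] with r hr hr1
    refine hr1.congr_of_eventuallyEq ?_
    filter_upwards [hVo.mem_nhds hr] with s hs
    rw [randersMetric_of_eq_zero (hS s hs).2]
  rw [← del_congr_of_eqOn hVo heq ⟨hp, hη⟩]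
  refine h.del_lagrProd_eq_zero hD isHomogeneous_randersMetric hVo hV
    (fun q hq c hc => ⟨hq.1, smul_ne_zero hc hq.2⟩) (fun q hq => ?_)
    (fun q hq => lagrProd_randersMetric_ne_zero hpos (hS q hq).1 hq.2) ⟨hp, hη⟩ k
  have : fund (randersMetric a b) q.1 q.2 = fund (hermitianMetric a) q.1 q.2 := by
    have : lagr (randersMetric a b) q.1 = lagr (hermitianMetric a) q.1 := by
      ext η; simp only [lagr, randersMetric_of_eq_zero (hS q hq).2]
    ext i j
    simp only [fund, Matrix.of_apply, dEta]
    congr 1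
    ext η
    simp only [dEtaBar, this]
  rw [this]
  exact det_fund_hermitianMetric hpos (hS q hq).1

include hD ha hpos hb in
-- If the derivative were nonzero at `z`, it would be nonzero nearby, so `b` would vanish near `z`;
-- but then `z` is interior to the zero set of `b`.
lemma del_sesqProd_eq_zero (hn : 2 ≤ n)
    (h : GeodesicsReparametrize D euclideanMetric (randersMetric a b))
    (hp : p.1 ∈ D) (hη : p.2 ≠ 0) (k : Fin n) : del (ez k) (sesqProd a) p = 0 := by
  by_contra hne
  have hU := isOpen_prod_univ hD
  have hc : ContinuousAt (fun z => del (ez k) (sesqProd a) (z, p.2)) p.1 := by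
    have h1 : ContinuousAt (del (ez k) (sesqProd a)) p :=
      (contDiffOn_del hU (contDiffOn_sesqProd ha)).continuousOn.continuousAt
        (hU.mem_nhds ⟨hp, trivial⟩)
    exact ContinuousAt.comp (f := fun z => (z, p.2)) (x := p.1) h1 (by fun_prop)
  have hev : ∀ᶠ z in 𝓝 p.1, z ∈ D ∧ b z = 0 := by
    filter_upwards [hc.eventually_ne hne, hD.mem_nhds hp] with z hz hzD
    refine ⟨hzD, ?_⟩
    by_contra hbz
    apply hz
    have key := fun v => fderiv_sesqProd_eq_zero hD ha hpos hb hn hzD hbz v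
      (fun η hη => fderiv_lagrProd_eq_zero (fun k =>
        del_lagrProd_randersMetric_eq_zero (p := (z, η)) hD ha hpos hb h ⟨hzD, hη⟩ k) v) p.2
    have e : Complex.I • (ez k : Cn n × Cn n) = (Complex.I • Pi.single k 1, 0) := by
      simp [ez]
    rw [del, e, key, ez, key]; simp
  exact hne (del_sesqProd_eq_zero_of_interior hD ha hpos h
    (mem_interior_iff_mem_nhds.mpr hev) hη k)

include hD hpos in
lemma isStationary_hermitianMetric
    (h : ∀ p : Cn n × Cn n, p.1 ∈ D → p.2 ≠ 0 → ∀ k, del (ez k) (sesqProd a) p = 0) :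
    IsStationary D (hermitianMetric a) := by
  intro p hp k
  rw [del_congr_of_eqOn (isOpen_prod_univ hD)
    (fun q hq => lagrProd_hermitianMetric hpos hq.1) ⟨hp.1, trivial⟩]
  exact h p hp.1 hp.2.1 k

include hD hpos in
-- A regular point may satisfy `β = 0`. If the derivative were nonzero there, continuity would force
-- `β = 0` on a neighbourhood, where `L = α²` is already stationary.
lemma isStationary_randersMetric
    (h : ∀ p : Cn n × Cn n, p.1 ∈ D → p.2 ≠ 0 → ∀ k, del (ez k) (sesqProd a) p = 0)
    (h' : ∀ p ∈ linNonzero D b, ∀ k, del (ez k) (lagrProd (randersMetric a b)) p = 0) :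
    IsStationary D (randersMetric a b) := by
  intro p hp k
  by_contra hne
  have hU := isOpen_regSet (F := randersMetric a b) hD
  have hc : ContinuousAt (del (ez k) (lagrProd (randersMetric a b))) p :=
    (contDiffOn_del hU contDiffOn_lagrProd).continuousOn.continuousAt (hU.mem_nhds hp)
  have hev : lagrProd (randersMetric a b) =ᶠ[𝓝 p] sesqProd a := by
    filter_upwards [hc.eventually_ne hne, hU.mem_nhds hp] with q hq hqD
    refine lagrProd_randersMetric_of_eq_zero hpos hqD.1 ?_
    by_contra hl
    exact hq (h' q ⟨hqD.1, hl⟩ k)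
  rw [del_congr hev] at hne
  exact hne (h p hp.1 hp.2.1 k)

end Stationary

/-! ### Differentiability of the spray, as needed for the product rule. -/

section SpraySmooth

lemma differentiableAt_det {E : Type*} [NormedAddCommGroup E] [NormedSpace ℝ E] {n : ℕ}
    {M : E → Matrix (Fin n) (Fin n) ℂ} {x : E} (hM : ∀ i j, DifferentiableAt ℝ (fun y => M y i j) x) :
    DifferentiableAt ℝ (fun y => (M y).det) x := by
  simp only [Matrix.det_apply]
  refine DifferentiableAt.fun_sum fun σ _ => DifferentiableAt.fun_const_smul ?_ _
  exact (HasFDerivAt.finsetProd (g := fun i y => M y (σ i) i)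
    fun i _ => (hM (σ i) i).hasFDerivAt).differentiableAt

lemma differentiableAt_inv_apply {E : Type*} [NormedAddCommGroup E] [NormedSpace ℝ E] {n : ℕ}
    {M : E → Matrix (Fin n) (Fin n) ℂ} {x : E} (hM : ∀ i j, DifferentiableAt ℝ (fun y => M y i j) x)
    (hdet : (M x).det ≠ 0) (i j : Fin n) : DifferentiableAt ℝ (fun y => (M y)⁻¹ i j) x := by
  simp only [Matrix.inv_def, Ring.inverse_eq_inv', Matrix.smul_apply, smul_eq_mul,
    Matrix.adjugate_apply]
  refine ((differentiableAt_det hM).inv hdet).mul (differentiableAt_det fun k l => ?_)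
  by_cases hk : k = j
  · subst hk; simp
  · simpa [Matrix.updateRow_ne hk] using hM k l

variable {n : ℕ} {F : Cn n → Cn n → ℝ} {U : Set (Cn n × Cn n)} {p : Cn n × Cn n}

lemma differentiableAt_slice_right {g : Cn n × Cn n → ℂ} (hg : DifferentiableAt ℝ g p) :
    DifferentiableAt ℝ (fun η => g (p.1, η)) p.2 :=
  DifferentiableAt.comp (g := g) p.2 hg ((differentiableAt_const p.1).prodMk differentiableAt_id)

lemma differentiableAt_spray (hF : IsHomogeneous F) (hU : IsOpen U)
    (hL : ContDiffOn ℝ ∞ (lagrProd F) U) (hp : p ∈ U) (hdet : (fund F p.1 p.2).det ≠ 0) (i : Fin n) :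
    DifferentiableAt ℝ (fun q : Cn n × Cn n => spray F i q.1 q.2) p := by
  have hfund : ∀ i j, DifferentiableAt ℝ (fun q : Cn n × Cn n => fund F q.1 q.2 i j) p := by
    intro i j
    refine (differentiableAt_of_contDiffOn hU (contDiffOn_del (u := ev i) hU
      (contDiffOn_dbar (u := ev j) hU hL)) hp).congr_of_eventuallyEq ?_
    filter_upwards [hU.mem_nhds hp] with q hq using fund_eq hU hL hq i j
  have hconn : ∀ i j, DifferentiableAt ℝ (fun q : Cn n × Cn n => nonlinConn F i j q.1 q.2) p := by
    intro i j
    have h1 : DifferentiableAt ℝ (fun q : Cn n × Cn n => ∑ m, fundInv F q.1 q.2 m i *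
        del (ez j) (dbar (ev m) (lagrProd F)) q) p :=
      DifferentiableAt.fun_sum fun m _ => (differentiableAt_inv_apply hfund hdet m i).fun_mul
        (differentiableAt_of_contDiffOn hU (contDiffOn_del hU (contDiffOn_dbar hU hL)) hp)
    refine h1.congr_of_eventuallyEq ?_
    filter_upwards [hU.mem_nhds hp] with q hq using nonlinConn_eq hF hU hL hq i j
  unfold spray
  exact (DifferentiableAt.fun_sum fun j _ =>
    (hconn i j).fun_mul (differentiableAt_real_snd_apply j)).const_mul _

end SpraySmooth

/-! ### A degree comparison in one antiholomorphic direction. -/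

section Antiholomorphic

/-- If `4 B Γ² = A m²`, where `Γ`, `m`, `A` are of degree at most one and `B` constant in the
`u`-antiholomorphic direction and `∂̄_u A ≠ 0`, then `Γ = 0`. -/
lemma eq_zero_of_dbar_sq {E : Type*} [NormedAddCommGroup E] [NormedSpace ℂ E] [NormedSpace ℝ E]
    {W : Set E} (hW : IsOpen W) {u : E} {Γ γ m d A e B : E → ℂ}
    (hΓ : ∀ x ∈ W, DifferentiableAt ℝ Γ x) (hγ : ∀ x ∈ W, DifferentiableAt ℝ γ x)
    (hm : ∀ x ∈ W, DifferentiableAt ℝ m x) (hd : ∀ x ∈ W, DifferentiableAt ℝ d x)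
    (hA : ∀ x ∈ W, DifferentiableAt ℝ A x) (he : ∀ x ∈ W, DifferentiableAt ℝ e x)
    (hB : ∀ x ∈ W, DifferentiableAt ℝ B x)
    (dΓ : ∀ x ∈ W, dbar u Γ x = γ x) (dγ : ∀ x ∈ W, dbar u γ x = 0)
    (dm : ∀ x ∈ W, dbar u m x = d x) (dd : ∀ x ∈ W, dbar u d x = 0)
    (dA : ∀ x ∈ W, dbar u A x = e x) (de : ∀ x ∈ W, dbar u e x = 0)
    (dB : ∀ x ∈ W, dbar u B x = 0) (hB0 : ∀ x ∈ W, B x ≠ 0) (he0 : ∀ x ∈ W, e x ≠ 0)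
    (h : ∀ x ∈ W, 4 * (B x * (Γ x * Γ x)) = A x * (m x * m x)) : ∀ x ∈ W, Γ x = 0 := by
  -- Three successive applications of `∂̄_u`. The left side has degree at most two and dies at the
  -- third, leaving only the top coefficient `e d²` of the right side.
  have h1 : ∀ x ∈ W, 8 * (B x * (Γ x * γ x)) = e x * (m x * m x) + 2 * (A x * (m x * d x)) := by
    intro x hx
    have := dbar_congr_of_eqOn (u := u) hW h hx
    rw [dbar_const_mul _ ((hB x hx).fun_mul ((hΓ x hx).fun_mul (hΓ x hx))),
      dbar_mul (hB x hx) ((hΓ x hx).fun_mul (hΓ x hx)), dbar_mul (hΓ x hx) (hΓ x hx),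
      dbar_mul (hA x hx) ((hm x hx).fun_mul (hm x hx)), dbar_mul (hm x hx) (hm x hx),
      dB x hx, dΓ x hx, dA x hx, dm x hx] at this
    linear_combination this
  have h2 : ∀ x ∈ W, 8 * (B x * (γ x * γ x)) = 4 * (e x * (m x * d x)) + 2 * (A x * (d x * d x)) := by
    intro x hx
    have := dbar_congr_of_eqOn (u := u) hW h1 hx
    rw [dbar_const_mul _ ((hB x hx).fun_mul ((hΓ x hx).fun_mul (hγ x hx))),
      dbar_mul (hB x hx) ((hΓ x hx).fun_mul (hγ x hx)), dbar_mul (hΓ x hx) (hγ x hx),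
      dbar_add ((he x hx).fun_mul ((hm x hx).fun_mul (hm x hx)))
        (((hA x hx).fun_mul ((hm x hx).fun_mul (hd x hx))).const_mul 2),
      dbar_mul (he x hx) ((hm x hx).fun_mul (hm x hx)), dbar_mul (hm x hx) (hm x hx),
      dbar_const_mul _ ((hA x hx).fun_mul ((hm x hx).fun_mul (hd x hx))),
      dbar_mul (hA x hx) ((hm x hx).fun_mul (hd x hx)), dbar_mul (hm x hx) (hd x hx),
      dB x hx, dΓ x hx, dγ x hx, dA x hx, dm x hx, dd x hx, de x hx] at this
    linear_combination this
  have h3 : ∀ x ∈ W, 6 * (e x * (d x * d x)) = 0 := by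
    intro x hx
    have := dbar_congr_of_eqOn (u := u) hW h2 hx
    rw [dbar_const_mul _ ((hB x hx).fun_mul ((hγ x hx).fun_mul (hγ x hx))),
      dbar_mul (hB x hx) ((hγ x hx).fun_mul (hγ x hx)), dbar_mul (hγ x hx) (hγ x hx),
      dbar_add (((he x hx).fun_mul ((hm x hx).fun_mul (hd x hx))).const_mul 4)
        (((hA x hx).fun_mul ((hd x hx).fun_mul (hd x hx))).const_mul 2),
      dbar_const_mul _ ((he x hx).fun_mul ((hm x hx).fun_mul (hd x hx))),
      dbar_const_mul _ ((hA x hx).fun_mul ((hd x hx).fun_mul (hd x hx))),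
      dbar_mul (he x hx) ((hm x hx).fun_mul (hd x hx)), dbar_mul (hm x hx) (hd x hx),
      dbar_mul (hA x hx) ((hd x hx).fun_mul (hd x hx)), dbar_mul (hd x hx) (hd x hx),
      dB x hx, dγ x hx, dA x hx, dm x hx, dd x hx, de x hx] at this
    linear_combination -this
  intro x hx
  -- The coefficients now vanish in turn, going back up the chain of derivatives.
  have d0 : d x = 0 := by simpa [he0 x hx] using h3 x hx
  have γ0 : γ x = 0 := by simpa [d0, hB0 x hx] using h2 x hx
  have m0 : m x = 0 := by simpa [d0, γ0, he0 x hx] using h1 x hx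
  simpa [m0, hB0 x hx] using h x hx

end Antiholomorphic

/-! ### A complex Berwald Randers metric over a stationary `α` is stationary. -/

section Berwald

variable {n : ℕ} {D : Set (Cn n)} {a : Cn n → Matrix (Fin n) (Fin n) ℂ} {b : Cn n → Cn n}
  {p : Cn n × Cn n}

variable (hD : IsOpen D) (ha : ∀ i j, ContDiffOn ℝ ∞ (fun z => a z i j) D)
  (hpos : ∀ z ∈ D, (a z).PosDef) (hb : ContDiffOn ℝ ∞ b D)

include hD ha hpos hb in
lemma differentiableAt_spray_randersMetric (hp : p ∈ linNonzero D b) (i : Fin n) :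
    DifferentiableAt ℝ (fun η => spray (randersMetric a b) i p.1 η) p.2 := by
  have h := differentiableAt_spray isHomogeneous_randersMetric (isOpen_linNonzero hD hb)
    (contDiffOn_lagrProd.mono (linNonzero_subset_regSet hD ha hpos hb)) hp
    (det_fund_randersMetric hD ha hpos hb hp) i
  exact differentiableAt_slice_right h

include hD ha hpos hb in
lemma dbar_spray_randersMetric (hB : IsGeneralizedBerwald D (randersMetric a b))
    (hp : p ∈ linNonzero D b) (i : Fin n) (v : Cn n) :
    dbar v (fun η => spray (randersMetric a b) i p.1 η) p.2 = 0 := by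
  have h := hB p.1 hp.1 p.2 (linNonzero_subset_regSet hD ha hpos hb hp).2 i
  rw [← sum_smul_single v, dbar_sum_dir]
  refine Finset.sum_eq_zero fun k _ => ?_
  rw [dbar_smul_dir, ← wirtBar_eq_dbar]
  exact mul_eq_zero_of_right _ (h k)

include hD ha hpos hb in
/-- The contraction of the spray of a Randers metric over a flat Hermitian metric. -/
lemma absProd_mul_sesq_spray
    (hα : ∀ p : Cn n × Cn n, p.1 ∈ D → p.2 ≠ 0 → ∀ k, del (ez k) (sesqProd a) p = 0)
    (hp : p ∈ linNonzero D b) :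
    2 * (absProd b p * sesq (a p.1) (fun i => spray (randersMetric a b) i p.1 p.2) p.2) =
      hermProd a p * (conj (linProd b p) * (∑ j, p.2 j * del (ez j) (linProd b) p -
        2 * linForm (b p.1) (fun i => spray (randersMetric a b) i p.1 p.2)) +
        linProd b p * ∑ j, p.2 j * conj (dbar (ez j) (linProd b) p)) := by
  have hU := isOpen_linNonzero hD hb
  have hL := contDiffOn_lagrProd.mono (linNonzero_subset_regSet hD ha hpos hb)
  have e := del_contract_spray isHomogeneous_randersMetric hU hL hp
    (det_fund_randersMetric hD ha hpos hb hp)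
  set G : Cn n := fun i => spray (randersMetric a b) i p.1 p.2 with hG
  set s := hermProd a p + absProd b p with hs
  have hs0 : s ≠ 0 := by
    intro h
    apply lagrProd_randersMetric_ne_zero (b := b) hpos hp.1 (snd_ne_zero_of_mem hp)
    rw [lagrProd_randersMetric, ← hs, h, zero_mul]
  have hd1 := differentiableAt_hermProd hD ha hpos hb hp
  have hd2 := differentiableAt_absProd hD hb hp
  have hdL : ∀ u, del u (lagrProd (randersMetric a b)) p =
      2 * s * (del u (hermProd a) p + del u (absProd b) p) := by
    intro u
    have : lagrProd (randersMetric a b) = fun q =>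
      (hermProd a q + absProd b q) * (hermProd a q + absProd b q) :=
      funext fun q => lagrProd_randersMetric
    rw [this, del_mul (hd1.fun_add hd2) (hd1.fun_add hd2), del_add hd1 hd2]
    ring
  have hσ0 : hermProd a p ≠ 0 := by
    have := hermitianMetric_pos hpos hp.1 (snd_ne_zero_of_mem hp)
    exact Complex.ofReal_ne_zero.mpr this.ne'
  have hez : ∀ k, del (ez k) (hermProd a) p = 0 := by
    intro k
    have h1 := del_hermProd hD ha hpos hb hp (ez k)
    rw [hα p hp.1 (snd_ne_zero_of_mem hp) k] at h1
    simpa [hσ0] using h1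
  -- The contraction identity for `L = s²`, divided by `2s`; on the right only `|β|` varies with the
  -- base point.
  have e1 : 2 * ∑ k, (del (ev k) (hermProd a) p + del (ev k) (absProd b) p) * G k =
      ∑ j, p.2 j * del (ez j) (absProd b) p := by
    apply mul_left_cancel₀ (mul_ne_zero two_ne_zero hs0)
    simp only [lagrFlow, hdL, hez, zero_add] at e
    have e' : ∀ k, spray (randersMetric a b) k p.1 p.2 = G k := fun _ => rfl
    simp only [e'] at e
    rw [Finset.mul_sum, Finset.mul_sum, Finset.mul_sum]
    calc _ = _ := Finset.sum_congr rfl fun k _ => by ring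
      _ = _ := e
      _ = _ := Finset.sum_congr rfl fun k _ => by ring
  have e2 : ∑ k, 2 * (hermProd a p * del (ev k) (hermProd a) p) * G k = sesq (a p.1) G p.2 := by
    rw [sesq_left_eq_sum]
    refine Finset.sum_congr rfl fun k _ => ?_
    rw [del_hermProd hD ha hpos hb hp, ev, del_sesqProd hD ha hp.1, mul_comm]
  have e3 : ∑ k, 2 * (absProd b p * del (ev k) (absProd b) p) * G k =
      conj (linProd b p) * linForm (b p.1) G := by
    rw [linForm, Finset.mul_sum]
    refine Finset.sum_congr rfl fun k _ => ?_
    rw [two_mul_del_absProd hD hb hp, ev, del_linProd hD hb hp.1, dbar_linProd hD hb hp.1]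
    simp [linForm, Pi.single_apply, mul_assoc]
  have e4 : ∑ j, p.2 j * (2 * (absProd b p * del (ez j) (absProd b) p)) =
      conj (linProd b p) * ∑ j, p.2 j * del (ez j) (linProd b) p +
        linProd b p * ∑ j, p.2 j * conj (dbar (ez j) (linProd b) p) := by
    rw [Finset.mul_sum, Finset.mul_sum, ← Finset.sum_add_distrib]
    refine Finset.sum_congr rfl fun j _ => ?_
    rw [two_mul_del_absProd hD hb hp]; ring
  have e5 : 2 * (absProd b p * sesq (a p.1) G p.2 +
      hermProd a p * (conj (linProd b p) * linForm (b p.1) G)) =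
      hermProd a p * ∑ j, p.2 j * (2 * (absProd b p * del (ez j) (absProd b) p)) := by
    have h1 : ∑ j, p.2 j * (2 * (absProd b p * del (ez j) (absProd b) p)) =
        2 * absProd b p * ∑ j, p.2 j * del (ez j) (absProd b) p := by
      rw [Finset.mul_sum]; exact Finset.sum_congr rfl fun j _ => by ring
    rw [h1, ← e1, ← e2, ← e3]
    simp only [Finset.mul_sum, ← Finset.sum_add_distrib]
    exact Finset.sum_congr rfl fun j _ => by ring
  rw [e4] at e5
  linear_combination e5

lemma differentiableAt_real_linForm {c η : Cn n} : DifferentiableAt ℝ (fun η => linForm c η) η := by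
  unfold linForm; fun_prop

include hD ha hpos hb in
-- Squaring `absProd_mul_sesq_spray` removes the roots `α` and `|β|`. Holomorphy of the spray makes
-- `Γ = a(G, η)` affine in the direction `ū`, so `eq_zero_of_dbar_sq` applies; the condition `a(η,
-- u) ≠ 0` is its requirement that `α²` has degree exactly one.
lemma spray_randersMetric_eq_zero
    (hα : ∀ p : Cn n × Cn n, p.1 ∈ D → p.2 ≠ 0 → ∀ k, del (ez k) (sesqProd a) p = 0)
    (hB : IsGeneralizedBerwald D (randersMetric a b)) {z : Cn n} (hz : z ∈ D) {u : Cn n}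
    (hu : linForm (b z) u = 0) {η : Cn n} (hη : linForm (b z) η ≠ 0) (hηu : sesq (a z) η u ≠ 0)
    (i : Fin n) : spray (randersMetric a b) i z η = 0 := by
  set W : Set (Cn n) := {ξ | linForm (b z) ξ ≠ 0 ∧ sesq (a z) ξ u ≠ 0} with hWdef
  have hWo : IsOpen W := by
    have h1 : Continuous fun ξ : Cn n => sesq (a z) ξ u := by
      simp only [sesq_eq_linForm]; exact continuous_linForm
    exact (isOpen_ne.preimage continuous_linForm).inter (isOpen_ne.preimage h1)
  let G : Fin n → Cn n → ℂ := fun i ξ => spray (randersMetric a b) i z ξ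
  have hGd : ∀ ξ ∈ W, ∀ i, DifferentiableAt ℝ (G i) ξ := fun ξ hξ i =>
    differentiableAt_spray_randersMetric (p := (z, ξ)) hD ha hpos hb ⟨hz, hξ.1⟩ i
  have hGbar : ∀ ξ ∈ W, ∀ i v, dbar v (G i) ξ = 0 := fun ξ hξ i v =>
    dbar_spray_randersMetric (p := (z, ξ)) hD ha hpos hb hB ⟨hz, hξ.1⟩ i v
  -- the contractions of the spray
  let Γ : Cn n → ℂ := fun ξ => ∑ i, G i ξ * sesq (a z) (Pi.single i 1) ξ
  let γ : Cn n → Cn n → ℂ := fun v ξ => ∑ i, sesq (a z) (Pi.single i 1) v * G i ξ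
  have hΓd : ∀ ξ ∈ W, DifferentiableAt ℝ Γ ξ := fun ξ hξ => DifferentiableAt.fun_sum fun i _ =>
    (hGd ξ hξ i).fun_mul differentiableAt_real_sesq_right
  have hγd : ∀ v, ∀ ξ ∈ W, DifferentiableAt ℝ (γ v) ξ := fun v ξ hξ =>
    DifferentiableAt.fun_sum fun i _ => (hGd ξ hξ i).const_mul _
  have dΓ : ∀ v, ∀ ξ ∈ W, dbar v Γ ξ = γ v ξ := by
    intro v ξ hξ
    have h1 : dbar v Γ ξ = _ := dbar_sum fun i _ =>
      (hGd ξ hξ i).fun_mul differentiableAt_real_sesq_right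
    rw [h1]
    refine Finset.sum_congr rfl fun i _ => ?_
    rw [dbar_mul (hGd ξ hξ i) differentiableAt_real_sesq_right, hGbar ξ hξ, dbar_sesq_right]
    ring
  have dγ : ∀ v, ∀ ξ ∈ W, dbar u (γ v) ξ = 0 := by
    intro v ξ hξ
    have h1 : dbar u (γ v) ξ = _ := dbar_sum fun i _ => (hGd ξ hξ i).const_mul _
    rw [h1]
    refine Finset.sum_eq_zero fun i _ => ?_
    rw [dbar_const_mul _ (hGd ξ hξ i), hGbar ξ hξ, mul_zero]
  -- the derivatives of `β` in the base directions, as forms in `ξ`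
  obtain ⟨b₁, hb₁⟩ : ∃ b₁ : Fin n → Cn n, ∀ j ξ, del (ez j) (linProd b) (z, ξ) = linForm (b₁ j) ξ := by
    refine ⟨fun j i => (1 / 2 : ℂ) * (fderiv ℝ (fun z => b z i) z (Pi.single j 1) -
      Complex.I * fderiv ℝ (fun z => b z i) z (Complex.I • Pi.single j 1)), fun j ξ => ?_⟩
    have e : Complex.I • (ez j : Cn n × Cn n) = (Complex.I • Pi.single j 1, 0) := by simp [ez]
    rw [del, e, ez, fderiv_linProd (p := (z, ξ)) hD hb hz, fderiv_linProd (p := (z, ξ)) hD hb hz]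
    simp only [linForm, Finset.mul_sum, ← Finset.sum_sub_distrib]
    exact Finset.sum_congr rfl fun i _ => by ring
  obtain ⟨b₂, hb₂⟩ : ∃ b₂ : Fin n → Cn n, ∀ j ξ, dbar (ez j) (linProd b) (z, ξ) = linForm (b₂ j) ξ := by
    refine ⟨fun j i => (1 / 2 : ℂ) * (fderiv ℝ (fun z => b z i) z (Pi.single j 1) +
      Complex.I * fderiv ℝ (fun z => b z i) z (Complex.I • Pi.single j 1)), fun j ξ => ?_⟩
    have e : Complex.I • (ez j : Cn n × Cn n) = (Complex.I • Pi.single j 1, 0) := by simp [ez]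
    rw [dbar, e, ez, fderiv_linProd (p := (z, ξ)) hD hb hz, fderiv_linProd (p := (z, ξ)) hD hb hz]
    simp only [linForm, Finset.mul_sum, ← Finset.sum_add_distrib]
    exact Finset.sum_congr rfl fun i _ => by ring
  let β : Cn n → ℂ := fun ξ => linForm (b z) ξ
  let P : Cn n → ℂ := fun ξ => ∑ j, ξ j * linForm (b₁ j) ξ + (-2) * ∑ i, b z i * G i ξ
  let Q : Cn n → ℂ := fun ξ => ∑ j, ξ j * conj (linForm (b₂ j) ξ)
  let Q₁ : Cn n → ℂ := fun ξ => ∑ j, ξ j * conj (linForm (b₂ j) u)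
  have hβd : ∀ ξ, DifferentiableAt ℝ β ξ := fun ξ => differentiableAt_real_linForm
  have hβcd : ∀ ξ, DifferentiableAt ℝ (fun ξ => conj (β ξ)) ξ := fun ξ => differentiableAt_conj (hβd ξ)
  have dβ : ∀ ξ, dbar u β ξ = 0 := fun ξ => dbar_linForm
  -- The choice of `u` in the kernel of `β(z, ·)` makes `β̄`, hence `|β|²`, constant in the
  -- direction `ū`.
  have dβc : ∀ ξ, dbar u (fun ξ => conj (β ξ)) ξ = 0 := fun ξ => by
    rw [dbar_conj]
    have : del u β ξ = linForm (b z) u := del_linForm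
    rw [this, hu, map_zero]
  have hPd1 : ∀ ξ, ∀ j, DifferentiableAt ℝ (fun ξ : Cn n => ξ j * linForm (b₁ j) ξ) ξ := fun ξ j =>
    (differentiableAt_apply_real j).fun_mul differentiableAt_real_linForm
  have hPd2 : ∀ ξ ∈ W, ∀ i, DifferentiableAt ℝ (fun ξ : Cn n => b z i * G i ξ) ξ := fun ξ hξ i =>
    (hGd ξ hξ i).const_mul _
  have hPd3 : ∀ ξ, DifferentiableAt ℝ (fun ξ : Cn n => ∑ j, ξ j * linForm (b₁ j) ξ) ξ := fun ξ =>
    DifferentiableAt.fun_sum fun j _ => hPd1 ξ j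
  have hPd4 : ∀ ξ ∈ W, DifferentiableAt ℝ (fun ξ : Cn n => ∑ i, b z i * G i ξ) ξ := fun ξ hξ =>
    DifferentiableAt.fun_sum fun j _ => hPd2 ξ hξ j
  have hPd : ∀ ξ ∈ W, DifferentiableAt ℝ P ξ := fun ξ hξ =>
    (hPd3 ξ).fun_add ((hPd4 ξ hξ).const_mul _)
  have dP : ∀ ξ ∈ W, dbar u P ξ = 0 := by
    intro ξ hξ
    have h1 : dbar u P ξ = _ := dbar_add (hPd3 ξ) ((hPd4 ξ hξ).const_mul _)
    rw [h1, dbar_const_mul _ (hPd4 ξ hξ), dbar_sum fun j _ => hPd1 ξ j,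
      dbar_sum fun j _ => hPd2 ξ hξ j]
    simp only [dbar_mul (differentiableAt_apply_real _) differentiableAt_real_linForm, dbar_linForm,
      dbar_apply, dbar_const_mul _ (hGd ξ hξ _), hGbar ξ hξ]
    simp
  have hQd1 : ∀ ξ, ∀ j, DifferentiableAt ℝ (fun ξ : Cn n => conj (linForm (b₂ j) ξ)) ξ := fun ξ j =>
    differentiableAt_conj differentiableAt_real_linForm
  have hQd : ∀ ξ, DifferentiableAt ℝ Q ξ := fun ξ => DifferentiableAt.fun_sum fun j _ =>
    (differentiableAt_apply_real j).fun_mul (hQd1 ξ j)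
  have dQ : ∀ ξ, dbar u Q ξ = Q₁ ξ := by
    intro ξ
    have h1 : dbar u Q ξ = _ := dbar_sum fun j _ =>
      (differentiableAt_apply_real j).fun_mul (hQd1 ξ j)
    rw [h1]
    refine Finset.sum_congr rfl fun j _ => ?_
    rw [dbar_mul (differentiableAt_apply_real j) (hQd1 ξ j), dbar_apply, dbar_conj, del_linForm]
    ring
  have hQ₁d : ∀ ξ, DifferentiableAt ℝ Q₁ ξ := fun ξ => DifferentiableAt.fun_sum fun j _ =>
    (differentiableAt_apply_real j).mul_const _
  have dQ₁ : ∀ ξ, dbar u Q₁ ξ = 0 := by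
    intro ξ
    have h1 : dbar u Q₁ ξ = _ := dbar_sum fun j _ => (differentiableAt_apply_real j).mul_const _
    rw [h1]
    refine Finset.sum_eq_zero fun j _ => ?_
    rw [dbar_mul (differentiableAt_apply_real j) (differentiableAt_const _), dbar_apply, dbar_const]
    ring
  have hΓ0 : ∀ ξ ∈ W, Γ ξ = 0 := by
    refine eq_zero_of_dbar_sq (u := u) (γ := γ u) (m := fun ξ => conj (β ξ) * P ξ + β ξ * Q ξ)
      (d := fun ξ => β ξ * Q₁ ξ) (A := fun ξ => sesq (a z) ξ ξ) (e := fun ξ => sesq (a z) ξ u)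
      (B := fun ξ => β ξ * conj (β ξ)) hWo hΓd (hγd u)
      (fun ξ hξ => ((hβcd ξ).fun_mul (hPd ξ hξ)).fun_add ((hβd ξ).fun_mul (hQd ξ)))
      (fun ξ hξ => (hβd ξ).fun_mul (hQ₁d ξ)) (fun ξ hξ => ?_)
      (fun ξ hξ => differentiableAt_real_sesq_left) (fun ξ hξ => (hβd ξ).fun_mul (hβcd ξ))
      (dΓ u) (dγ u) (fun ξ hξ => ?_) (fun ξ hξ => ?_) (fun ξ hξ => dbar_sesq_self)
      (fun ξ hξ => dbar_sesq_left) (fun ξ hξ => ?_) (fun ξ hξ => ?_) (fun ξ hξ => hξ.2)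
      (fun ξ hξ => ?_)
    · have : (fun ξ => sesq (a z) ξ ξ) = fun ξ : Cn n => ∑ i, ξ i * sesq (a z) (Pi.single i 1) ξ := by
        ext; exact sesq_left_eq_sum
      rw [this]
      exact DifferentiableAt.fun_sum fun i _ =>
        (differentiableAt_apply_real i).fun_mul differentiableAt_real_sesq_right
    · rw [dbar_add ((hβcd ξ).fun_mul (hPd ξ hξ)) ((hβd ξ).fun_mul (hQd ξ)),
        dbar_mul (hβcd ξ) (hPd ξ hξ), dbar_mul (hβd ξ) (hQd ξ), dβ, dβc, dP ξ hξ, dQ]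
      ring
    · rw [dbar_mul (hβd ξ) (hQ₁d ξ), dβ, dQ₁]; ring
    · rw [dbar_mul (hβd ξ) (hβcd ξ), dβ, dβc]; ring
    · exact mul_ne_zero hξ.1 (by simpa using hξ.1)
    · have hq : ((z, ξ) : Cn n × Cn n) ∈ linNonzero D b := ⟨hz, hξ.1⟩
      have e := absProd_mul_sesq_spray hD ha hpos hb hα hq
      have eΓ : sesq (a z) (fun i => spray (randersMetric a b) i z ξ) ξ = Γ ξ := sesq_left_eq_sum
      have eb : linForm (b z) (fun i => spray (randersMetric a b) i z ξ) = ∑ i, b z i * G i ξ := rfl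
      simp only [hb₁, hb₂, eΓ, eb] at e
      have e' : 2 * (absProd b (z, ξ) * Γ ξ) =
          hermProd a (z, ξ) * (conj (β ξ) * P ξ + β ξ * Q ξ) := by
        rw [e]
        simp only [β, P, Q, linProd]
        ring
      have hs1 := hermProd_mul_self (a := a) (p := (z, ξ)) hpos hz
      have hs2 := absProd_mul_self (b := b) (p := (z, ξ))
      have hs1' : hermProd a (z, ξ) * hermProd a (z, ξ) = sesq (a z) ξ ξ := hs1
      have hs2' : absProd b (z, ξ) * absProd b (z, ξ) = β ξ * conj (β ξ) := hs2
      rw [← hs1', ← hs2']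
      linear_combination (2 * (absProd b (z, ξ) * Γ ξ) +
          hermProd a (z, ξ) * (conj (β ξ) * P ξ + β ξ * Q ξ)) * e'
  have hGz : (fun i => spray (randersMetric a b) i z η) = 0 := by
    -- As `Γ` vanishes on an open set, so does `∂̄_w Γ = a(G, w)` for every `w`, and `a` is
    -- nondegenerate.
    refine eq_zero_of_sesq_left (hpos z hz) fun w => ?_
    have h1 : γ w η = 0 := by
      rw [← dΓ w η ⟨hη, hηu⟩, dbar_congr_of_eqOn (g := fun _ => 0) hWo hΓ0 ⟨hη, hηu⟩, dbar_const]
    rw [← h1, sesq_left_eq_sum]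
    exact Finset.sum_congr rfl fun i _ => mul_comm _ _
  exact congrFun hGz i

include hD ha hpos hb in
-- With the spray zero, the flow `ηʲ ∂L/∂zʲ` is zero too, and the Kähler condition reduces the
-- contracted torsion formula to `0 = 2 ∂L/∂zᵏ`.
lemma del_lagrProd_randersMetric_eq_zero_of_berwald (hn : 2 ≤ n)
    (hα : ∀ p : Cn n × Cn n, p.1 ∈ D → p.2 ≠ 0 → ∀ k, del (ez k) (sesqProd a) p = 0)
    (hB : IsComplexBerwald D (randersMetric a b)) (hp : p ∈ linNonzero D b) (k : Fin n) :
    del (ez k) (lagrProd (randersMetric a b)) p = 0 := by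
  obtain ⟨z, η⟩ := p
  have hz : z ∈ D := hp.1
  have hη : linForm (b z) η ≠ 0 := hp.2
  obtain ⟨u, hu0, hu⟩ := exists_linForm_eq_zero hn (b z)
  have hU := isOpen_linNonzero hD hb
  have hL : ContDiffOn ℝ ∞ (lagrProd (randersMetric a b)) (linNonzero D b) :=
    contDiffOn_lagrProd.mono (linNonzero_subset_regSet hD ha hpos hb)
  have hspray : ∀ ξ, linForm (b z) ξ ≠ 0 → sesq (a z) ξ u ≠ 0 → ∀ i,
      spray (randersMetric a b) i z ξ = 0 := fun ξ h1 h2 =>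
    spray_randersMetric_eq_zero hD ha hpos hb hα hB.2 hz hu h1 h2
  have hflow : ∀ ξ, linForm (b z) ξ ≠ 0 → sesq (a z) ξ u ≠ 0 →
      lagrFlow (randersMetric a b) (z, ξ) = 0 := fun ξ h1 h2 => by
    have hq : ((z, ξ) : Cn n × Cn n) ∈ linNonzero D b := ⟨hz, h1⟩
    rw [← del_contract_spray isHomogeneous_randersMetric hU hL hq
      (det_fund_randersMetric hD ha hpos hb hq)]
    simp [hspray ξ h1 h2]
  have main : ∀ ξ, linForm (b z) ξ ≠ 0 → sesq (a z) ξ u ≠ 0 →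
      del (ez k) (lagrProd (randersMetric a b)) (z, ξ) = 0 := by
    intro ξ h1 h2
    have hq : ((z, ξ) : Cn n × Cn n) ∈ linNonzero D b := ⟨hz, h1⟩
    have e := del_contract_torsion isHomogeneous_randersMetric hU hL hq
      (det_fund_randersMetric hD ha hpos hb hq) k
    have hK : ∀ i, ∑ j, torsion (randersMetric a b) i j k z ξ * ξ j = 0 := fun i =>
      hB.1 z hz ξ (linNonzero_subset_regSet hD ha hpos hb hq).2 i k
    have hfd : DifferentiableAt ℝ (lagrFlow (randersMetric a b)) (z, ξ) :=
      DifferentiableAt.fun_sum fun j _ => (differentiableAt_real_snd_apply j).fun_mul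
        (differentiableAt_of_contDiffOn hU (contDiffOn_del hU hL) hq)
    -- The vector `u` depends on `z`, so the flow is known to vanish only within the fibre over `z`;
    -- a fibre derivative requires no more.
    have hf0 : del (ev k) (lagrFlow (randersMetric a b)) (z, ξ) = 0 := by
      have h3 := del_slice_right hfd (Pi.single k 1)
      rw [ev, ← h3]
      have h4 : (fun ξ => lagrFlow (randersMetric a b) (z, ξ)) =ᶠ[𝓝 ξ] fun _ => 0 := by
        have c1 : Continuous fun ξ : Cn n => sesq (a z) ξ u := by
          simp only [sesq_eq_linForm]; exact continuous_linForm
        filter_upwards [continuous_linForm.continuousAt.eventually_ne h1,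
          c1.continuousAt.eventually_ne h2] with ζ h5 h6 using hflow ζ h5 h6
      rw [del_congr h4, del_const]
    rw [hf0] at e
    simp only [hK, hspray ξ h1 h2, mul_zero, zero_mul, Finset.sum_const_zero, sub_zero,
      add_zero] at e
    simpa using e.symm
  -- The excluded directions are reached as limits of `η + tu`: there `β` is unchanged and `a(η +
  -- tu, u) = t a(u, u) ≠ 0`.
  by_cases h2 : sesq (a z) η u = 0
  · have hc : ContinuousAt (fun t : ℝ => del (ez k) (lagrProd (randersMetric a b))
        (z, η + (t : ℂ) • u)) 0 := by
      have h1 : ContinuousAt (del (ez k) (lagrProd (randersMetric a b))) (z, η + ((0 : ℝ) : ℂ) • u) := by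
        have : ((z, η + ((0 : ℝ) : ℂ) • u) : Cn n × Cn n) = (z, η) := by simp
        rw [this]
        exact (contDiffOn_del hU hL).continuousOn.continuousAt (hU.mem_nhds hp)
      exact ContinuousAt.comp (f := fun t : ℝ => (z, η + (t : ℂ) • u)) (x := 0) h1 (by fun_prop)
    have := eq_zero_of_eventually_punctured hc (by
      filter_upwards [self_mem_nhdsWithin] with t ht
      have ht' : (t : ℂ) ≠ 0 := by exact_mod_cast ht
      have huu : sesq (a z) u u ≠ 0 := fun h => by
        have := sesq_self_pos (hpos z hz) hu0
        rw [h] at this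
        simp at this
      refine main _ ?_ ?_
      · rw [linForm_add, linForm_smul, hu, mul_zero, add_zero]; exact hη
      · rw [sesq_add_left, sesq_smul_left, h2, zero_add]; exact mul_ne_zero ht' huu)
    simpa using this
  · exact main η hη h2

end Berwald
end ComplexFinsler

end

/-! ### The equivalence. -/

open ComplexFinsler in
theorem theorem4p4 (n : ℕ) (hn : 2 ≤ n)
    (D : Set (Fin n → ℂ)) (hDopen : IsOpen D) (hDconn : IsConnected D)
    (a : (Fin n → ℂ) → Matrix (Fin n) (Fin n) ℂ)
    (ha_smooth : ∀ i j, ContDiffOn ℝ ∞ (fun z => a z i j) D)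
    (ha_pos : ∀ z ∈ D, (a z).PosDef)
    (b : (Fin n → ℂ) → (Fin n → ℂ)) (hb_smooth : ContDiffOn ℝ ∞ b D) :
    ComplexFinsler.ProjectivelyRelated D ComplexFinsler.euclideanMetric
        (ComplexFinsler.randersMetric a b) ↔
      ComplexFinsler.ProjectivelyRelated D (ComplexFinsler.hermitianMetric a)
          ComplexFinsler.euclideanMetric ∧
        ComplexFinsler.IsComplexBerwald D (ComplexFinsler.randersMetric a b) := by
  have hE : IsStationary D (euclideanMetric (n := n)) := isStationary_euclideanMetric hDopen
  constructor
  · rintro ⟨h, -⟩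
    have hα : ∀ p : Cn n × Cn n, p.1 ∈ D → p.2 ≠ 0 → ∀ k, del (ez k) (sesqProd a) p = 0 :=
      fun p hp hη k => del_sesqProd_eq_zero hDopen ha_smooth ha_pos hb_smooth hn h hp hη k
    have hR := isStationary_randersMetric (b := b) hDopen ha_pos hα fun p hp k =>
      del_lagrProd_randersMetric_eq_zero hDopen ha_smooth ha_pos hb_smooth h hp k
    exact ⟨(isStationary_hermitianMetric hDopen ha_pos hα).projectivelyRelated hDopen hE,
      hR.isComplexBerwald hDopen⟩
  -- Only the reparametrization of straight lines as geodesics of `α` is used from projective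
  -- relatedness.
  · rintro ⟨⟨-, h⟩, hB⟩
    have hα : ∀ p : Cn n × Cn n, p.1 ∈ D → p.2 ≠ 0 → ∀ k, del (ez k) (sesqProd a) p = 0 := by
      intro p hp hη k
      have hV := isOpen_prod_ne hDopen
      rw [← del_congr_of_eqOn (isOpen_prod_univ hDopen)
        (fun q hq => lagrProd_hermitianMetric ha_pos hq.1) ⟨hp, trivial⟩]
      refine h.del_lagrProd_eq_zero hDopen isHomogeneous_hermitianMetric hV
        (fun q hq => mem_regSet_hermitianMetric hDopen ha_smooth ha_pos hq.1 hq.2)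
        (fun q hq c hc => ⟨hq.1, smul_ne_zero hc hq.2⟩)
        (fun q hq => det_fund_hermitianMetric ha_pos hq.1) (fun q hq => ?_) ⟨hp, hη⟩ k
      rw [lagrProd, lagr]
      exact_mod_cast (pow_pos (hermitianMetric_pos ha_pos hq.1 hq.2) 2).ne'
    exact hE.projectivelyRelated hDopen (isStationary_randersMetric hDopen ha_pos hα fun p hp k =>
      del_lagrProd_randersMetric_eq_zero_of_berwald hDopen ha_smooth ha_pos hb_smooth hn hα hB hp k)
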